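/- Let $S$ be a closed (compact, without boundary), connected, oriented surface with a flat cone metric $\sigma$: a length metric such that every point $p\in S$ has a neighbourhood isometric to a neighbourhood of the vertex of a Euclidean cone of some cone angle $\theta(p)\ge 2\pi$, with $\theta(p)=2\pi$ for all but finitely many $p$. The points with $\theta(p)\neq 2\pi$ are called cone points, the other points are called nonsingular. Let $\mathrm{Hol}(S)\subset SO(2)$ be the holonomy group of $\sigma$, that is, the group of rotations of tangent planes obtained by parallel transport along closed curves consisting of nonsingular points. We say that $\sigma$ comes from a holomorphic quadratic differential if there are a complex structure on $S$, compatible with its orientation, and a holomorphic quadratic differential $q\not\equiv 0$ on the resulting Riemann surface such that every point at which $q\neq 0$ has a neighbourhood with a holomorphic coordinate $\xi$ in which $q=d\xi^2$ and which is an isometry for $\sigma$ onto an open subset of the Euclidean plane $\mathbb C$. Then $\sigma$ comes from a holomorphic quadratic differential if and only if both of the following hold: 1. the cone angle of every cone point is $k\pi$ for some integer $k\ge 3$; 2. $\mathrm{Hol}(S)\subseteq\{\pm\mathrm{Id}\}$. -/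

import Mathlib

open scoped Manifold ContDiff Topology

noncomputable section

/-- The distance of the Euclidean cone of cone angle `θ` (finitely many Euclidean sectors of total
angle `θ`, glued cyclically with their vertices identified) between the points with polar
coordinates `x = (r, a)` and `y = (s, b)`, where `r, s ≥ 0` and `a, b ∈ ℝ / θℤ`. The norm on
`AddCircle θ` is the distance to `0` along the circle of length `θ`; two points whose angular
distance is at least `π` are joined by a geodesic through the vertex, so that their distance
is `r + s`. -/
def coneDist (θ : ℝ) (x y : ℝ × AddCircle θ) : ℝ :=
  √(x.1 ^ 2 + y.1 ^ 2 - 2 * x.1 * y.1 * Real.cos (min ‖x.2 - y.2‖ Real.pi))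

section Metric

variable {S : Type*} [MetricSpace S]

/-- The point `p` has a neighbourhood which is isometric to a neighbourhood of the vertex of a
Euclidean cone of cone angle `θ`: a parametrization `f` of a small ball around `p` by the
polar coordinates of the cone preserves distances and sends the vertex to `p`. -/
def HasConeAngle (p : S) (θ : ℝ) : Prop :=
  0 < θ ∧ ∃ ε > 0, ∃ f : ℝ × AddCircle θ → S,
    (∀ a, f (0, a) = p) ∧
    (∀ x y : ℝ × AddCircle θ, x.1 ∈ Set.Ico 0 ε → y.1 ∈ Set.Ico 0 ε →
      dist (f x) (f y) = coneDist θ x y) ∧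
    f '' {x | x.1 ∈ Set.Ico 0 ε} = Metric.ball p ε

/-- A nonsingular point: the metric is Euclidean near `p`. -/
def IsRegularPoint (p : S) : Prop := HasConeAngle p (2 * Real.pi)

variable (S) in
/-- The distance of `S` is that of a nonpositively curved flat cone metric. -/
structure IsFlatConeMetric : Prop where
  /-- The distance is a length metric: it is the infimum of the lengths of paths. -/
  length_metric : ∀ x y : S, ∀ ε > 0, ∃ γ : Path x y,
    eVariationOn γ Set.univ ≤ ENNReal.ofReal (dist x y + ε)
  /-- Every point has a neighbourhood isometric to one of the vertex of a Euclidean cone, and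
  all cone angles are at least `2π`. -/
  locally_cone : ∀ p : S, ∃ θ, 2 * Real.pi ≤ θ ∧ HasConeAngle p θ
  /-- All but finitely many points have cone angle `2π`. -/
  finite_singular : {p : S | ¬ IsRegularPoint p}.Finite

variable (S) in
/-- An orientation of a flat cone surface, as an oriented flat atlas of the nonsingular part: a
collection of isometric charts with values in `ℂ` that cover the nonsingular points, all of
whose coordinate changes are orientation preserving, that is, locally of the form
`z ↦ a z + b` with `|a| = 1`. (The singular points are isolated points of a surface, so an
orientation of their complement is the same thing as an orientation of the surface.) -/
structure FlatOrientation where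
  charts : Set (OpenPartialHomeomorph S ℂ)
  isometric : ∀ e ∈ charts, ∀ x ∈ e.source, ∀ y ∈ e.source, dist (e x) (e y) = dist x y
  covers : ∀ p : S, IsRegularPoint p → ∃ e ∈ charts, p ∈ e.source
  compatible : ∀ e ∈ charts, ∀ e' ∈ charts, ∀ p, p ∈ e.source → p ∈ e'.source →
    ∃ (a : Circle) (b : ℂ), ∀ᶠ x in 𝓝 p, e' x = a * e x + b

namespace FlatOrientation

/-- A tangent vector field along the path `γ` that is parallel for the flat metric. The number
`v t e` is the coordinate, in the oriented flat chart `e` around `γ t`, of the vector at time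
`t`. It changes with the chart by the derivative of the coordinate change, and in a fixed flat
chart it is locally constant in `t`. -/
structure IsParallelAlong (O : FlatOrientation S) {p q : S} (γ : Path p q)
    (v : unitInterval → OpenPartialHomeomorph S ℂ → ℂ) : Prop where
  change_of_chart : ∀ t, ∀ e ∈ O.charts, ∀ e' ∈ O.charts, γ t ∈ e.source → γ t ∈ e'.source →
    v t e' = deriv (e' ∘ e.symm) (e (γ t)) * v t e
  locally_constant : ∀ t, ∀ e ∈ O.charts, γ t ∈ e.source → ∀ᶠ s in 𝓝 t, v s e = v t e

/-- The closed curve `γ` consists of nonsingular points, and parallel transport along `γ` is the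
rotation by `h` (rotations of the oriented tangent plane being multiplications by unit
complex numbers). -/
def HasHolonomy (O : FlatOrientation S) {p : S} (γ : Path p p) (h : Circle) : Prop :=
  (∀ t, IsRegularPoint (γ t)) ∧
  ∃ v, O.IsParallelAlong γ v ∧
    ∃ e ∈ O.charts, p ∈ e.source ∧ v 0 e ≠ 0 ∧ v 1 e = h * v 0 e

/-- The holonomy group, as a subgroup of `SO(2) = Circle`: it consists of the holonomies of the
closed curves in the nonsingular part. (As `SO(2)` is abelian, the base points play no role.) -/
def holonomyGroup (O : FlatOrientation S) : Subgroup Circle :=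
  Subgroup.closure {h | ∃ (p : S) (γ : Path p p), O.HasHolonomy γ h}

end FlatOrientation

end Metric

/-- A holomorphic quadratic differential on a Riemann surface `X`: in each holomorphic coordinate
`z = φ` it is `f dz²` with `f = coeff φ` holomorphic, and these expressions agree under changes
of coordinates. -/
structure HolomorphicQuadraticDifferential (X : Type*) [TopologicalSpace X] [ChartedSpace ℂ X] where
  coeff : OpenPartialHomeomorph X ℂ → ℂ → ℂ
  holomorphic : ∀ φ ∈ IsManifold.maximalAtlas 𝓘(ℂ) ω X, DifferentiableOn ℂ (coeff φ) φ.target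
  transform : ∀ φ ∈ IsManifold.maximalAtlas 𝓘(ℂ) ω X, ∀ ψ ∈ IsManifold.maximalAtlas 𝓘(ℂ) ω X,
    ∀ p, p ∈ φ.source → p ∈ ψ.source →
      coeff φ (φ p) = coeff ψ (ψ p) * deriv (ψ ∘ φ.symm) (φ p) ^ 2

namespace HolomorphicQuadraticDifferential

variable {X : Type*} [TopologicalSpace X] [ChartedSpace ℂ X]

/-- `p` is not a zero of `q`. -/
def NonzeroAt (q : HolomorphicQuadraticDifferential X) (p : X) : Prop :=
  q.coeff (chartAt ℂ p) (chartAt ℂ p p) ≠ 0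

/-- `ξ` is a natural coordinate for `q`: a holomorphic coordinate in which `q = dξ²`. -/
def IsNaturalCoordinate (q : HolomorphicQuadraticDifferential X)
    (ξ : OpenPartialHomeomorph X ℂ) : Prop :=
  ξ ∈ IsManifold.maximalAtlas 𝓘(ℂ) ω X ∧ ∀ z ∈ ξ.target, q.coeff ξ z = 1

end HolomorphicQuadraticDifferential

/-- The flat cone metric of `S`, with orientation `O`, is the metric given by the holomorphic
quadratic differential `q`: `q` is not identically zero, and around each point that is not a
zero of `q` there is a natural coordinate `ξ` that is an isometry onto its image in `ℂ` and is
positively oriented. (The zeros are isolated, so this determines the length metric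
of `S` also near them.) -/
def IsMetricOf {S : Type*} [MetricSpace S] (O : FlatOrientation S) [ChartedSpace ℂ S]
    (q : HolomorphicQuadraticDifferential S) : Prop :=
  (∃ p, q.NonzeroAt p) ∧
  ∀ p, q.NonzeroAt p → ∃ ξ : OpenPartialHomeomorph S ℂ, p ∈ ξ.source ∧ q.IsNaturalCoordinate ξ ∧
    (∀ x ∈ ξ.source, ∀ y ∈ ξ.source, dist (ξ x) (ξ y) = dist x y) ∧
    (∀ e ∈ O.charts, ∀ x, x ∈ e.source → x ∈ ξ.source →
      ∃ (a : Circle) (b : ℂ), ∀ᶠ y in 𝓝 x, ξ y = a * e y + b)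

/-- The flat cone metric of the oriented surface `S` comes from a holomorphic quadratic
differential, for some Riemann surface structure on `S`. -/
def ComesFromQuadraticDifferential {S : Type*} [MetricSpace S] (O : FlatOrientation S) : Prop :=
  ∃ _ : ChartedSpace ℂ S, IsManifold 𝓘(ℂ) ω S ∧
    ∃ q : HolomorphicQuadraticDifferential S, IsMetricOf O q

end

/-! A quadratic differential is a quadratic form on tangent vectors. The one that defines the metric
is parallel, and a parallel form exists exactly when parallel transport around loops is trivial up
to sign.

Suppose that the metric comes from `q`. Then `q` does not vanish at nonsingular points: read in a
flat chart it has absolute value 1 off isolated points, and by removable singularities also at them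
(`IsMetricOf.nonzeroAt_of_isRegularPoint`). So natural coordinates exist around every nonsingular
point, they differ from flat charts by motions, and `q` takes a constant value on a vector
transported in parallel. A holonomy `h` therefore satisfies `h ^ 2 = 1` (`IsMetricOf.holonomy_sq`).
A small circle around a point of cone angle `θ` has holonomy `exp (-iθ)`
(`IsPolar.exists_hasHolonomy`), so `θ` is a multiple of `π`, at least `3π` once it exceeds `2π`. The
condition on the angles is thus a consequence of the one on the holonomy.

Conversely, let all holonomies be `±1`. The nonsingular part is connected, so a unit vector at a
base point can be carried to every nonsingular point. The result `w` is unique up to sign, and the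
form `Q` with `Q(w) = 1` is well defined and parallel
(`FlatOrientation.exists_isParallelQuadratic`). The complex structure is given by the flat charts
together with, at a cone point of angle `2πβ`, a coordinate `z` in which the flat coordinate is `z ^
β` up to a motion. There the coefficient of `Q` has absolute value `β² |z| ^ (2β - 2)`, which tends
to 0 because `β > 1`. Extended by 0 it is continuous, hence holomorphic.

The local geometry is handled by logarithmic polar coordinates `P ζ`, with radius `exp (Re ζ)` and
angle `Im ζ`. An oriented flat chart reads in them as `c * exp ζ + d`
(`HasConeAngle.exists_isPolar`). -/

section FlatConeSurfaces

open Complex Filter Set Metric ComplexConjugate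

/-! ### Distance preserving maps of plane discs -/

section PlaneIsometries

/-- The distances from `h x` to the fixed points `0` and `δ` determine its real part, and its
imaginary part up to sign. The sign is the same for all `x`, being decided by the image of `δ * I`.
-/
theorem eq_or_eq_conj_of_isometry_of_fixed {h : ℂ → ℂ} {ρ δ : ℝ} (hδ : 0 < δ) (hδρ : δ < ρ)
    (h0 : h 0 = 0) (hd : h δ = δ)
    (hh : ∀ x ∈ ball (0 : ℂ) ρ, ∀ y ∈ ball (0 : ℂ) ρ, dist (h x) (h y) = dist x y) :
    (∀ x ∈ ball (0 : ℂ) ρ, h x = x) ∨ (∀ x ∈ ball (0 : ℂ) ρ, h x = conj x) := by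
  have key : ∀ x ∈ ball (0 : ℂ) ρ, ∀ y ∈ ball (0 : ℂ) ρ,
      ((h x).re - (h y).re) ^ 2 + ((h x).im - (h y).im) ^ 2
        = (x.re - y.re) ^ 2 + (x.im - y.im) ^ 2 := by
    intro x hx y hy
    have := hh x hx y hy
    rw [Complex.dist_eq_re_im, Complex.dist_eq_re_im] at this
    rwa [Real.sqrt_inj (by positivity) (by positivity)] at this
  have m0 : (0 : ℂ) ∈ ball (0 : ℂ) ρ := by simp; linarith
  have m1 : (δ : ℂ) ∈ ball (0 : ℂ) ρ := by simpa [abs_of_pos hδ] using hδρ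
  have m2 : (δ * I : ℂ) ∈ ball (0 : ℂ) ρ := by simpa [abs_of_pos hδ] using hδρ
  have hre : ∀ x ∈ ball (0 : ℂ) ρ, (h x).re = x.re := by
    intro x hx
    have e0 := key x hx 0 m0
    have e1 := key x hx δ m1
    simp only [h0, hd, zero_re, zero_im, ofReal_re, ofReal_im, sub_zero] at e0 e1
    have : δ * ((h x).re - x.re) = 0 := by nlinarith
    rcases mul_eq_zero.1 this with h | h <;> linarith
  have him : ∀ x ∈ ball (0 : ℂ) ρ, (h x).im ^ 2 = x.im ^ 2 := by
    intro x hx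
    have e0 := key x hx 0 m0
    simp only [h0, zero_re, zero_im, sub_zero, hre x hx] at e0
    linarith
  have hi := him _ m2
  have hr := hre _ m2
  simp only [mul_im, ofReal_re, I_im, mul_one, ofReal_im, I_re, mul_zero, add_zero, mul_re,
    sub_zero] at hi hr
  rcases sq_eq_sq_iff_eq_or_eq_neg.1 hi with hi | hi
  · left
    intro x hx
    have e2 := key x hx _ m2
    simp [hi, hr, hre x hx] at e2
    have e1 := him x hx
    apply Complex.ext (hre x hx)
    have : δ * ((h x).im - x.im) = 0 := by nlinarith
    rcases mul_eq_zero.1 this with h | h <;> linarith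
  · right
    intro x hx
    have e2 := key x hx _ m2
    simp [hi, hr, hre x hx] at e2
    have e1 := him x hx
    apply Complex.ext (by simpa using hre x hx)
    have : δ * ((h x).im + x.im) = 0 := by nlinarith
    rw [conj_im]
    rcases mul_eq_zero.1 this with h | h <;> linarith

/-- A distance preserving map from a disc to the plane is a Euclidean motion. -/
theorem local_isometry_complex {g : ℂ → ℂ} {z₀ : ℂ} {ρ : ℝ} (hρ : 0 < ρ)
    (hg : ∀ x ∈ ball z₀ ρ, ∀ y ∈ ball z₀ ρ, dist (g x) (g y) = dist x y) :
    ∃ (c : Circle) (d : ℂ), (∀ x ∈ ball z₀ ρ, g x = c * x + d) ∨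
      (∀ x ∈ ball z₀ ρ, g x = c * conj x + d) := by
  set δ := ρ / 2 with hδ
  have hδ0 : 0 < δ := by positivity
  have hδ1 : (δ : ℂ) ≠ 0 := by exact_mod_cast hδ0.ne'
  have hm : ∀ x, x ∈ ball (0 : ℂ) ρ → z₀ + x ∈ ball z₀ ρ := by
    intro x hx; simpa using hx
  have n0 : (0 : ℂ) ∈ ball (0 : ℂ) ρ := by simpa using hρ
  have n1 : (δ : ℂ) ∈ ball (0 : ℂ) ρ := by simp [abs_of_pos hδ0]; linarith
  have hnorm : ‖(g (z₀ + δ) - g z₀) / δ‖ = 1 := by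
    have := hg _ (hm _ n1) _ (hm _ n0)
    rw [add_zero, dist_eq_norm, dist_eq_norm] at this
    rw [norm_div, this]
    simp [hδ0.ne']
  let c : Circle := ⟨(g (z₀ + δ) - g z₀) / δ, mem_sphere_zero_iff_norm.2 hnorm⟩
  have hc : (c : ℂ) = (g (z₀ + δ) - g z₀) / δ := rfl
  have hc0 : (c : ℂ) ≠ 0 := c.coe_ne_zero
  have hcn : ‖(c : ℂ)‖ = 1 := hnorm
  have hgc : g (z₀ + δ) - g z₀ = c * δ := by rw [hc]; field_simp
  -- After a translation and the rotation by `c⁻¹`, the map fixes `0` and `δ`.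
  have main := eq_or_eq_conj_of_isometry_of_fixed (h := fun x => (g (z₀ + x) - g z₀) / c)
    (ρ := ρ) (δ := δ) hδ0 (by linarith) (by simp) (by simp only [hgc]; field_simp)
    (by
      intro x hx y hy
      have := hg _ (hm _ hx) _ (hm _ hy)
      rw [dist_eq_norm] at this ⊢
      rw [← sub_div, norm_div, hcn]
      simpa using this)
  have hx' : ∀ x, x ∈ ball z₀ ρ → x - z₀ ∈ ball (0 : ℂ) ρ := by
    intro x hx; simpa [dist_eq_norm] using hx
  rcases main with h | h
  · refine ⟨c, g z₀ - c * z₀, Or.inl fun x hx => ?_⟩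
    have := h _ (hx' x hx)
    simp only [add_sub_cancel] at this
    rw [div_eq_iff hc0] at this
    linear_combination this
  · refine ⟨c, g z₀ - c * conj z₀, Or.inr fun x hx => ?_⟩
    have := h _ (hx' x hx)
    simp only [add_sub_cancel, map_sub] at this
    rw [div_eq_iff hc0] at this
    linear_combination this

/-- Increments in the direction `1` force `A = 1`, those in the direction `I` force `A = -1`. This
is what separates orientation preserving from orientation reversing coordinates. -/
theorem not_eventually_conj_eq_affine (A B w : ℂ) : ¬ ∀ᶠ z in 𝓝 w, conj z = A * z + B := by
  intro h
  obtain ⟨ρ, hρ, hb⟩ := Metric.eventually_nhds_iff_ball.1 h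
  have hδ0 : 0 < ρ / 2 := by positivity
  have hδ : ((ρ / 2 : ℝ) : ℂ) ≠ 0 := by exact_mod_cast hδ0.ne'
  have e0 := hb w (mem_ball_self hρ)
  have e1 := hb (w + (ρ / 2 : ℝ)) (by
    rw [mem_ball, dist_self_add_left, norm_real, Real.norm_of_nonneg hδ0.le]; linarith)
  have e2 := hb (w + (ρ / 2 : ℝ) * I) (by
    rw [mem_ball, dist_self_add_left, norm_mul, norm_real, Real.norm_of_nonneg hδ0.le]
    simp; linarith)
  rw [map_add, conj_ofReal] at e1
  rw [map_add, map_mul, conj_I, conj_ofReal] at e2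
  have hA : A = 1 := by
    apply mul_right_cancel₀ hδ
    linear_combination e0 - e1
  have : (((ρ / 2 : ℝ) : ℂ)) * (2 * I) = 0 := by
    subst hA; linear_combination e0 - e2
  simp at this
  exact hρ.ne' this

end PlaneIsometries

/-! ### The metric of a Euclidean cone -/

section Cone

variable {θ : ℝ}

/-- This is the law of cosines. The bound `h1` makes the circle norm equal to the difference of the
angles, and `h2` makes the cap at `π` ineffective. -/
theorem coneDist_eq_dist_exp (hθ : 0 < θ) {ζ ζ' : ℂ} (h1 : |ζ.im - ζ'.im| ≤ θ / 2)
    (h2 : |ζ.im - ζ'.im| ≤ Real.pi) :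
    coneDist θ (Real.exp ζ.re, (ζ.im : AddCircle θ)) (Real.exp ζ'.re, (ζ'.im : AddCircle θ))
      = dist (exp ζ) (exp ζ') := by
  unfold coneDist
  have hn : ‖((ζ.im : AddCircle θ) - (ζ'.im : AddCircle θ))‖ = |ζ.im - ζ'.im| := by
    rw [← AddCircle.coe_sub]
    exact (AddCircle.norm_coe_eq_abs_iff θ hθ.ne').2 (by rwa [abs_of_pos hθ])
  simp only [hn, min_eq_left h2, Real.cos_abs]
  rw [Complex.dist_eq_re_im]
  congr 1
  simp only [exp_re, exp_im, Real.cos_sub]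
  nlinarith [Real.sin_sq_add_cos_sq ζ.im, Real.sin_sq_add_cos_sq ζ'.im]

theorem continuous_coneDist_right (x : ℝ × AddCircle θ) : Continuous (coneDist θ x) := by
  unfold coneDist
  fun_prop

theorem coneDist_self (x : ℝ × AddCircle θ) : coneDist θ x x = 0 := by
  simp only [coneDist, sub_self, norm_zero, min_eq_left Real.pi_pos.le, Real.cos_zero]
  rw [Real.sqrt_eq_zero']
  nlinarith

theorem coneDist_zero_left {a : AddCircle θ} {y : ℝ × AddCircle θ} (hy : 0 ≤ y.1) :
    coneDist θ (0, a) y = y.1 := by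
  simp [coneDist, Real.sqrt_sq hy]

/-- Distinct points of a cone have positive distance. -/
theorem eq_of_coneDist_eq_zero {x y : ℝ × AddCircle θ} (hx : 0 < x.1) (hy : 0 < y.1)
    (h : coneDist θ x y = 0) : x = y := by
  unfold coneDist at h
  set m := min ‖x.2 - y.2‖ Real.pi with hm
  have hm0 : 0 ≤ m := le_min (norm_nonneg _) Real.pi_pos.le
  have hmpi : m ≤ Real.pi := min_le_right _ _
  rw [Real.sqrt_eq_zero'] at h
  have hc := Real.cos_le_one m
  have hxy := mul_pos hx hy
  have h1 : x.1 = y.1 := by nlinarith [sq_nonneg (x.1 - y.1)]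
  have h2 : Real.cos m = 1 := by
    have : 0 ≤ x.1 * y.1 * (Real.cos m - 1) := by nlinarith [sq_nonneg (x.1 - y.1)]
    have := nonneg_of_mul_nonneg_right this hxy
    linarith
  have h3 : m = 0 := by
    rw [Real.cos_eq_one_iff_of_lt_of_lt (by linarith [Real.pi_pos]) (by linarith [Real.pi_pos])] at h2
    exact h2
  have h4 : ‖x.2 - y.2‖ = 0 := by
    rcases min_choice ‖x.2 - y.2‖ Real.pi with h | h
    · rw [← h, ← hm, h3]
    · have := Real.pi_pos
      rw [← h, ← hm, h3] at this
      exact absurd this (lt_irrefl _)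
  exact Prod.ext h1 (sub_eq_zero.1 (norm_eq_zero.1 h4))

end Cone

/-! ### Logarithmic polar coordinates -/

variable {S : Type*} [MetricSpace S]

/-- Logarithmic polar coordinates around `p`, on the half plane `Re ζ < R`, without any condition
on the orientation. -/
structure IsPrePolar (p : S) (θ R : ℝ) (P : ℂ → S) : Prop where
  pos : 0 < θ
  dist_eq : ∀ ζ ζ' : ℂ, ζ.re < R → ζ'.re < R → dist (P ζ) (P ζ') =
    coneDist θ (Real.exp ζ.re, (ζ.im : AddCircle θ)) (Real.exp ζ'.re, (ζ'.im : AddCircle θ))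
  periodic : ∀ ζ, P (ζ + θ * I) = P ζ
  dist_center : ∀ ζ : ℂ, ζ.re < R → dist (P ζ) p = Real.exp ζ.re
  surj : ∀ x ∈ ball p (Real.exp R), x ≠ p → ∃ ζ : ℂ, ζ.re < R ∧ P ζ = x

theorem HasConeAngle.exists_isPrePolar {p : S} {θ : ℝ} (h : HasConeAngle p θ) :
    ∃ R P, IsPrePolar p θ R P := by
  obtain ⟨hθ, ε, hε, f, h0, hd, him⟩ := h
  have hlt : ∀ ζ : ℂ, ζ.re < Real.log ε → Real.exp ζ.re ∈ Ico 0 ε := fun ζ hζ =>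
    ⟨(Real.exp_pos _).le, (Real.lt_log_iff_exp_lt hε).1 hζ⟩
  refine ⟨Real.log ε, fun ζ => f (Real.exp ζ.re, (ζ.im : AddCircle θ)), hθ, ?_, ?_, ?_, ?_⟩
  · intro ζ ζ' hζ hζ'
    exact hd _ _ (hlt ζ hζ) (hlt ζ' hζ')
  · intro ζ
    simp
  · intro ζ hζ
    have := hd (0, 0) (Real.exp ζ.re, (ζ.im : AddCircle θ)) ⟨le_rfl, hε⟩ (hlt ζ hζ)
    rw [h0, coneDist_zero_left (Real.exp_pos _).le, dist_comm] at this
    exact this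
  · intro x hx hxp
    rw [Real.exp_log hε, ← him] at hx
    obtain ⟨⟨r, a⟩, hr, rfl⟩ := hx
    have hr0 : 0 < r := by
      rcases hr.1.lt_or_eq with h | h
      · exact h
      · exfalso
        apply hxp
        simp only at h
        rw [← h]
        exact h0 a
    obtain ⟨t, rfl⟩ := QuotientAddGroup.mk_surjective a
    refine ⟨⟨Real.log r, t⟩, Real.log_lt_log hr0 hr.2, ?_⟩
    simp [Real.exp_log hr0]

namespace IsPrePolar

variable {p : S} {θ R : ℝ} {P : ℂ → S}

theorem mono (h : IsPrePolar p θ R P) {R' : ℝ} (hR : R' ≤ R) : IsPrePolar p θ R' P where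
  pos := h.pos
  dist_eq ζ ζ' hζ hζ' := h.dist_eq ζ ζ' (hζ.trans_le hR) (hζ'.trans_le hR)
  periodic := h.periodic
  dist_center ζ hζ := h.dist_center ζ (hζ.trans_le hR)
  surj x hx hxp := by
    obtain ⟨ζ, hζ, rfl⟩ := h.surj x (ball_subset_ball (Real.exp_le_exp.2 hR) hx) hxp
    rw [mem_ball, h.dist_center ζ hζ, Real.exp_lt_exp] at hx
    exact ⟨ζ, hx, rfl⟩

theorem periodic_int (h : IsPrePolar p θ R P) (n : ℤ) (ζ : ℂ) : P (ζ + n * (θ * I)) = P ζ := by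
  have : Function.Periodic P (θ * I) := h.periodic
  exact this.int_mul n ζ

theorem reflect (h : IsPrePolar p θ R P) : IsPrePolar p θ R (fun ζ => P (conj ζ)) where
  pos := h.pos
  dist_eq ζ ζ' hζ hζ' := by
    rw [h.dist_eq _ _ (by simpa using hζ) (by simpa using hζ')]
    have : ‖-(ζ.im : AddCircle θ) - -(ζ'.im : AddCircle θ)‖
        = ‖(ζ.im : AddCircle θ) - (ζ'.im : AddCircle θ)‖ := by
      rw [← norm_neg]; congr 1; abel
    simp only [coneDist, conj_re, conj_im, AddCircle.coe_neg, this]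
  periodic ζ := by
    have := h.periodic_int (-1) (conj ζ)
    simpa using this
  dist_center ζ hζ := by
    simpa using h.dist_center (conj ζ) (by simpa using hζ)
  surj x hx hxp := by
    obtain ⟨ζ, hζ, rfl⟩ := h.surj x hx hxp
    exact ⟨conj ζ, by simpa using hζ, by simp⟩

theorem isOpen_half (R : ℝ) : IsOpen {ζ : ℂ | ζ.re < R} := isOpen_lt continuous_re continuous_const

theorem continuousAt (h : IsPrePolar p θ R P) {ζ : ℂ} (hζ : ζ.re < R) : ContinuousAt P ζ := by
  rw [ContinuousAt, tendsto_iff_dist_tendsto_zero]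
  have hc : Continuous fun ζ' : ℂ => coneDist θ (Real.exp ζ.re, (ζ.im : AddCircle θ))
      (Real.exp ζ'.re, (ζ'.im : AddCircle θ)) :=
    (continuous_coneDist_right _).comp ((Real.continuous_exp.comp continuous_re).prodMk
      ((AddCircle.continuous_mk' θ).comp continuous_im))
  have := hc.tendsto ζ
  rw [coneDist_self] at this
  refine this.congr' ?_
  filter_upwards [(isOpen_half R).mem_nhds hζ] with ζ' hζ'
  rw [dist_comm, h.dist_eq _ _ hζ hζ']

theorem eq_iff (h : IsPrePolar p θ R P) {ζ ζ' : ℂ} (hζ : ζ.re < R) (hζ' : ζ'.re < R)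
    (he : P ζ = P ζ') : ∃ n : ℤ, ζ' = ζ + n * (θ * I) := by
  have := h.dist_eq ζ ζ' hζ hζ'
  rw [he, dist_self] at this
  have := eq_of_coneDist_eq_zero (Real.exp_pos _) (Real.exp_pos _) this.symm
  simp only [Prod.mk.injEq, Real.exp_eq_exp] at this
  obtain ⟨hr, hi⟩ := this
  have : ((ζ'.im - ζ.im : ℝ) : AddCircle θ) = 0 := by rw [AddCircle.coe_sub, hi, sub_self]
  obtain ⟨n, hn⟩ := (AddCircle.coe_eq_zero_iff θ).1 this
  refine ⟨n, Complex.ext (by simp [hr]) ?_⟩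
  simp only [zsmul_eq_mul] at hn
  simp [hn]

theorem ne_center (h : IsPrePolar p θ R P) {ζ : ℂ} (hζ : ζ.re < R) : P ζ ≠ p := by
  intro he
  have := h.dist_center ζ hζ
  rw [he, dist_self] at this
  exact (Real.exp_pos _).ne this

theorem mem_ball (h : IsPrePolar p θ R P) {ζ : ℂ} (hζ : ζ.re < R) : P ζ ∈ ball p (Real.exp R) := by
  rw [Metric.mem_ball, h.dist_center ζ hζ]; exact Real.exp_lt_exp.2 hζ

theorem image_half (h : IsPrePolar p θ R P) :
    P '' {ζ | ζ.re < R} = ball p (Real.exp R) \ {p} := by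
  ext x
  constructor
  · rintro ⟨ζ, hζ, rfl⟩
    exact ⟨h.mem_ball hζ, h.ne_center hζ⟩
  · rintro ⟨hx, hxp⟩
    exact h.surj x hx hxp

theorem isPreconnected_half (R : ℝ) : IsPreconnected {ζ : ℂ | ζ.re < R} :=
  (convex_halfSpace_re_lt R).isPreconnected

/-- In a chart that is an isometry, the polar coordinates are the standard ones up to a motion. -/
theorem exists_motion (h : IsPrePolar p θ R P) {e : OpenPartialHomeomorph S ℂ}
    (he : ∀ x ∈ e.source, ∀ y ∈ e.source, dist (e x) (e y) = dist x y) {ζ₀ : ℂ} (hζ₀ : ζ₀.re < R)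
    (hs : P ζ₀ ∈ e.source) :
    ∃ (c : Circle) (d : ℂ), (∀ᶠ ζ in 𝓝 ζ₀, e (P ζ) = c * exp ζ + d) ∨
      (∀ᶠ ζ in 𝓝 ζ₀, e (P ζ) = c * conj (exp ζ) + d) := by
  set w₀ := exp ζ₀ with hw₀
  have hw0 : w₀ ≠ 0 := exp_ne_zero _
  -- `L` is the branch of the logarithm near `w₀` with `L w₀ = ζ₀`.
  let L : ℂ → ℂ := fun w => log (w / w₀) + ζ₀
  have hL0 : L w₀ = ζ₀ := by simp [L, div_self hw0]
  have hLc : ContinuousAt L w₀ := by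
    refine ContinuousAt.add (ContinuousAt.clog (by fun_prop) ?_) continuousAt_const
    rw [div_self hw0]; exact one_mem_slitPlane
  have hLe : ∀ w, w ≠ 0 → exp (L w) = w := by
    intro w hw
    simp only [L]
    rw [exp_add, exp_log (div_ne_zero hw hw0), ← hw₀]
    field_simp
  -- For angle differences up to `m`, both bounds in `coneDist_eq_dist_exp` hold.
  set m := min (θ / 2) Real.pi with hm
  have hm0 : 0 < m := lt_min (half_pos h.pos) Real.pi_pos
  have hLc' : Tendsto L (𝓝 w₀) (𝓝 ζ₀) := by simpa [ContinuousAt, hL0] using hLc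
  have ev : ∀ᶠ w in 𝓝 w₀, (L w).re < R ∧ dist (L w) ζ₀ < m / 2 ∧ P (L w) ∈ e.source ∧ w ≠ 0 := by
    refine (hLc'.eventually ((isOpen_half R).mem_nhds hζ₀)).and
      ((hLc'.eventually (ball_mem_nhds ζ₀ (half_pos hm0))).and (Filter.Eventually.and ?_ ?_))
    · exact hLc'.eventually ((h.continuousAt hζ₀).eventually (e.open_source.mem_nhds hs))
    · exact isOpen_ne.mem_nhds hw0
  obtain ⟨ρ, hρ, hb⟩ := Metric.eventually_nhds_iff_ball.1 ev
  obtain ⟨c, d, hcd⟩ := local_isometry_complex (g := fun w => e (P (L w))) hρ (by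
    intro x hx y hy
    obtain ⟨hx1, hx2, hx3, hx4⟩ := hb x hx
    obtain ⟨hy1, hy2, hy3, hy4⟩ := hb y hy
    have hd : |(L x).im - (L y).im| ≤ m := by
      calc |(L x).im - (L y).im| = |(L x - L y).im| := by rw [sub_im]
        _ ≤ ‖L x - L y‖ := abs_im_le_norm _
        _ = dist (L x) (L y) := (dist_eq_norm _ _).symm
        _ ≤ dist (L x) ζ₀ + dist (L y) ζ₀ := dist_triangle_right _ _ _
        _ ≤ m := by linarith
    rw [he _ hx3 _ hy3, h.dist_eq _ _ hx1 hy1, coneDist_eq_dist_exp h.pos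
      (hd.trans (min_le_left _ _)) (hd.trans (min_le_right _ _)), hLe x hx4, hLe y hy4])
  have hback : ∀ᶠ ζ in 𝓝 ζ₀, exp ζ ∈ ball w₀ ρ ∧ L (exp ζ) = ζ := by
    refine Filter.Eventually.and (continuous_exp.continuousAt.eventually (ball_mem_nhds _ hρ)) ?_
    filter_upwards [ball_mem_nhds ζ₀ Real.pi_pos] with ζ hζ
    simp only [L]
    have h2 : |(ζ - ζ₀).im| < Real.pi :=
      (abs_im_le_norm _).trans_lt (by rwa [← dist_eq_norm])
    rw [hw₀, ← exp_sub, log_exp (abs_lt.1 h2).1 (abs_lt.1 h2).2.le]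
    ring
  refine ⟨c, d, hcd.imp (fun hcd => ?_) (fun hcd => ?_)⟩ <;>
  · filter_upwards [hback] with ζ hζ
    have := hcd _ hζ.1
    rwa [hζ.2] at this

end IsPrePolar

/-- Positively oriented logarithmic polar coordinates around `p`. -/
structure IsPolar (O : FlatOrientation S) (p : S) (θ R : ℝ) (P : ℂ → S) : Prop
    extends IsPrePolar p θ R P where
  regular : ∀ ζ : ℂ, ζ.re < R → IsRegularPoint (P ζ)
  motion : ∀ ζ₀ : ℂ, ζ₀.re < R → ∀ e ∈ O.charts, P ζ₀ ∈ e.source →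
    ∃ (c : Circle) (d : ℂ), ∀ᶠ ζ in 𝓝 ζ₀, e (P ζ) = c * exp ζ + d

/-- The exponential has nonzero derivative, so it maps neighbourhoods onto neighbourhoods. -/
theorem eventually_of_eventually_exp {Q : ℂ → Prop} {ζ₀ : ℂ} (h : ∀ᶠ ζ in 𝓝 ζ₀, Q (exp ζ)) :
    ∀ᶠ w in 𝓝 (exp ζ₀), Q w := by
  have : Filter.map exp (𝓝 ζ₀) = 𝓝 (exp ζ₀) :=
    (Complex.hasStrictDerivAt_exp ζ₀).map_nhds_eq (exp_ne_zero _)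
  rw [← this]
  exact h

theorem HasConeAngle.exists_isPolar (hS : {p : S | ¬ IsRegularPoint p}.Finite)
    (O : FlatOrientation S) {p : S} {θ : ℝ} (h : HasConeAngle p θ) :
    ∃ R P, IsPolar O p θ R P := by
  obtain ⟨R₀, P, hP₀⟩ := h.exists_isPrePolar
  obtain ⟨ρ, hρ, hreg⟩ : ∃ ρ > 0, ∀ x ∈ ball p ρ, x ≠ p → IsRegularPoint x := by
    have : ({p : S | ¬ IsRegularPoint p} \ {p})ᶜ ∈ 𝓝 p :=
      (hS.subset sdiff_subset).isClosed.isOpen_compl.mem_nhds (by simp)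
    obtain ⟨ρ, hρ, hb⟩ := Metric.mem_nhds_iff.1 this
    refine ⟨ρ, hρ, fun x hx hxp => ?_⟩
    by_contra hc
    exact hb hx ⟨hc, hxp⟩
  set R := min R₀ (Real.log ρ) with hR
  have hP : IsPrePolar p θ R P := hP₀.mono (min_le_left _ _)
  have hexp : Real.exp R ≤ ρ := by
    rw [← Real.exp_log hρ]; exact Real.exp_le_exp.2 (min_le_right _ _)
  have hr : ∀ ζ : ℂ, ζ.re < R → IsRegularPoint (P ζ) := fun ζ hζ =>
    hreg _ (ball_subset_ball hexp (hP.mem_ball hζ)) (hP.ne_center hζ)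
  -- `A id` and `A conj` are the places where the polar coordinates preserve, respectively reverse,
  -- the orientation. They are open and disjoint and cover the connected half plane, so one of them
  -- is all of it. In the second case `P` is replaced by its reflection.
  let A : (ℂ → ℂ) → Set ℂ := fun τ => {ζ₀ | ζ₀.re < R ∧ ∃ e ∈ O.charts, P ζ₀ ∈ e.source ∧
    ∃ (c : Circle) (d : ℂ), ∀ᶠ ζ in 𝓝 ζ₀, e (P ζ) = c * τ (exp ζ) + d}
  have hAo : ∀ τ, IsOpen (A τ) := by
    intro τ
    rw [isOpen_iff_mem_nhds]
    rintro ζ₀ ⟨h0, e, he, hs, c, d, hcd⟩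
    filter_upwards [(IsPrePolar.isOpen_half R).mem_nhds h0,
      (hP.continuousAt h0).eventually (e.open_source.mem_nhds hs), hcd.eventually_nhds]
      with ζ h1 h2 h3
    exact ⟨h1, e, he, h2, c, d, h3⟩
  have hcov : ∀ ζ₀ : ℂ, ζ₀.re < R → ∀ e ∈ O.charts, P ζ₀ ∈ e.source →
      (∃ (c : Circle) (d : ℂ), ∀ᶠ ζ in 𝓝 ζ₀, e (P ζ) = c * exp ζ + d) ∨
      (∃ (c : Circle) (d : ℂ), ∀ᶠ ζ in 𝓝 ζ₀, e (P ζ) = c * conj (exp ζ) + d) := by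
    intro ζ₀ h0 e he hs
    obtain ⟨c, d, h⟩ := hP.exists_motion (O.isometric e he) h0 hs
    exact h.imp (fun h => ⟨c, d, h⟩) (fun h => ⟨c, d, h⟩)
  have hdisj : ∀ ζ₀, ζ₀ ∈ A id → ζ₀ ∉ A conj := by
    rintro ζ₀ ⟨h0, e, he, hs, c, d, hcd⟩ ⟨-, e', he', hs', c', d', hcd'⟩
    obtain ⟨a, b, hab⟩ := O.compatible e he e' he' _ hs hs'
    apply not_eventually_conj_eq_affine (a * c / c') ((a * d + b - d') / c') (exp ζ₀)
    apply eventually_of_eventually_exp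
    filter_upwards [hcd, hcd', (hP.continuousAt h0).eventually hab] with ζ h1 h2 h3
    have := c'.coe_ne_zero
    rw [h1, h2] at h3
    simp only [id] at h3
    field_simp
    linear_combination h3
  have hpc := IsPrePolar.isPreconnected_half R
  have hsub : {ζ : ℂ | ζ.re < R} ⊆ A id ∪ A conj := by
    intro ζ hζ
    obtain ⟨e, he, hs⟩ := O.covers _ (hr ζ hζ)
    exact (hcov ζ hζ e he hs).imp (fun h => ⟨hζ, e, he, hs, h⟩) (fun h => ⟨hζ, e, he, hs, h⟩)
  rcases isPreconnected_iff_subset_of_disjoint.1 hpc _ _ (hAo id) (hAo conj) hsub (by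
    ext ζ
    simp only [mem_inter_iff, mem_empty_iff_false, iff_false]
    rintro ⟨-, h1, h2⟩
    exact hdisj ζ h1 h2) with hA | hA
  · refine ⟨R, P, hP, hr, fun ζ₀ h0 e he hs => ?_⟩
    rcases hcov ζ₀ h0 e he hs with h | h
    · exact h
    · exact absurd ⟨h0, e, he, hs, h⟩ (hdisj ζ₀ (hA h0))
  · refine ⟨R, _, hP.reflect, fun ζ hζ => hr _ (by simpa using hζ), fun ζ₀ h0 e he hs => ?_⟩
    have h0' : (conj ζ₀).re < R := by simpa using h0
    rcases hcov _ h0' e he hs with h | ⟨c, d, h⟩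
    · exact absurd (hA h0') (hdisj _ ⟨h0', e, he, hs, h⟩)
    · refine ⟨c, d, ?_⟩
      filter_upwards [continuous_conj.continuousAt.eventually h] with ζ hζ
      rw [hζ, ← exp_conj, conj_conj]

/-! ### Uniqueness of the cone angle -/

section AngleUniqueness

/-- Since `0 < |i - j| < N`, the integer `i - j - m * N` is never zero, whatever the multiple `m *
T` subtracted. -/
theorem AddCircle.le_norm_coe_mul_sub {T δ : ℝ} {N : ℕ} (hδ : 0 < δ) (hT : T = N * δ) {i j : ℕ}
    (hi : i < N) (hj : j < N) (hij : i ≠ j) :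
    δ ≤ ‖(((i * δ : ℝ) : AddCircle T) - ((j * δ : ℝ) : AddCircle T))‖ := by
  rw [← AddCircle.coe_sub, AddCircle.norm_eq]
  set m := round (T⁻¹ * (i * δ - j * δ))
  have : (i * δ - j * δ - m * T : ℝ) = ((i - j - m * N : ℤ) : ℝ) * δ := by
    rw [hT]; push_cast; ring
  rw [this, abs_mul, abs_of_pos hδ]
  have hne : (i - j - m * N : ℤ) ≠ 0 := by
    intro h0
    have h1 : (N : ℤ) ∣ (i : ℤ) - j := ⟨m, by linarith⟩
    have h2 : |(i : ℤ) - j| < N := by rw [abs_lt]; omega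
    have := Int.eq_zero_of_abs_lt_dvd h1 h2
    omega
  have : (1 : ℝ) ≤ |((i - j - m * N : ℤ) : ℝ)| := by exact_mod_cast Int.one_le_abs hne
  nlinarith

theorem AddCircle.mul_le_of_separated {T δ : ℝ} (hT : 0 < T) {N : ℕ} (hN : 2 ≤ N)
    (a : Fin N → AddCircle T) (ha : ∀ i j, i ≠ j → δ ≤ ‖a i - a j‖) : N * δ ≤ T := by
  have : Fact (0 < T) := ⟨hT⟩
  have hN0 : (0 : ℝ) < N := by positivity
  by_contra! hlt
  -- `2 * r` is the midpoint of `T / N` and `δ`: the balls of radius `r` are disjoint, yet `N` arcs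
  -- of length `2 * r` exceed the circle.
  set r := (T / N + δ) / 4 with hr
  have hTN : T / N < δ := (div_lt_iff₀' hN0).2 hlt
  have hTN0 : 0 < T / N := by positivity
  have h2r : 2 * r < δ := by linarith
  have h2r' : T < N * (2 * r) := by
    have : T / N < 2 * r := by linarith
    rwa [div_lt_iff₀' hN0] at this
  have hdisj : Pairwise (Function.onFun Disjoint fun i => closedBall (a i) r) := by
    intro i j hij
    apply closedBall_disjoint_closedBall
    have := ha i j hij
    rw [dist_eq_norm]; linarith
  have hsum := MeasureTheory.sum_measure_le_measure_univ (μ := MeasureTheory.volume)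
    (s := Finset.univ) (t := fun i => closedBall (a i) r)
    (fun i _ => measurableSet_closedBall.nullMeasurableSet)
    (fun i _ j _ hij => (hdisj hij).aedisjoint)
  simp only [AddCircle.volume_closedBall, AddCircle.measure_univ, Finset.sum_const, Finset.card_univ,
    Fintype.card_fin, nsmul_eq_mul] at hsum
  rw [← ENNReal.ofReal_natCast, ← ENNReal.ofReal_mul hN0.le, ENNReal.ofReal_le_ofReal_iff hT.le] at hsum
  have hN2 : (2 : ℝ) ≤ N := by exact_mod_cast hN
  -- A closed ball has length `min T (2 * r)`; if it is the whole circle, the contradiction comes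
  -- from `2 ≤ N`.
  rcases min_choice T (2 * r) with h | h <;> rw [h] at hsum <;> nlinarith

/-- Put `N` equally spaced points on a circle around `p` in the coordinates `P'`. The coordinates
`P` give them the same radius, so their mutual distances determine the angular distances capped at
`π`. With spacing `δ ≤ π` the points are also `δ`-separated on the circle of length `θ`, and a
packing bound gives `N * δ ≤ θ`. -/
theorem IsPrePolar.angle_le {p : S} {θ θ' R R' : ℝ} {P P' : ℂ → S} (h₀ : IsPrePolar p θ R P)
    (h₀' : IsPrePolar p θ' R' P') : θ' ≤ θ := by
  set R₀ := min R R'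
  have h := h₀.mono (min_le_left R R')
  have h' := h₀'.mono (min_le_right R R')
  obtain ⟨N, hN⟩ := exists_nat_gt (θ' / Real.pi + 2)
  have hN0 : (0 : ℝ) < N := by
    have := div_pos h'.pos Real.pi_pos
    linarith
  have hN2 : 2 ≤ N := by
    have := div_pos h'.pos Real.pi_pos
    have : (2 : ℝ) < N := by linarith
    exact_mod_cast this.le
  set δ := θ' / N with hδ
  have hδ0 : 0 < δ := div_pos h'.pos hN0
  have hT : θ' = N * δ := by rw [hδ]; field_simp
  have hδpi : δ ≤ Real.pi := by
    rw [hδ, div_le_iff₀ hN0, ← div_le_iff₀' Real.pi_pos]; linarith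
  set ρ := R₀ - 1
  let ζ' : Fin N → ℂ := fun j => ⟨ρ, j * δ⟩
  have hζ' : ∀ j, (ζ' j).re < R₀ := fun j => by simp [ζ', ρ]
  have hex : ∀ j, ∃ ζ : ℂ, ζ.re = ρ ∧ P ζ = P' (ζ' j) := by
    intro j
    obtain ⟨ζ, h1, h2⟩ := h.surj _ (h'.mem_ball (hζ' j)) (h'.ne_center (hζ' j))
    refine ⟨ζ, ?_, h2⟩
    have := h.dist_center ζ h1
    rw [h2, h'.dist_center _ (hζ' j), Real.exp_eq_exp] at this
    exact this.symm
  choose ζ hζ1 hζ2 using hex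
  have hζ : ∀ j, (ζ j).re < R₀ := fun j => by rw [hζ1]; simp [ρ]
  rw [hT]
  refine AddCircle.mul_le_of_separated h.pos hN2 (fun j => ((ζ j).im : AddCircle θ)) ?_
  intro i j hij
  have hd : δ ≤ ‖(((ζ' i).im : AddCircle θ') - ((ζ' j).im : AddCircle θ'))‖ :=
    AddCircle.le_norm_coe_mul_sub hδ0 hT i.2 j.2 (fun h => hij (Fin.ext h))
  have e1 := h.dist_eq _ _ (hζ i) (hζ j)
  rw [hζ2, hζ2, h'.dist_eq _ _ (hζ' i) (hζ' j)] at e1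
  simp only [coneDist, hζ1] at e1
  set m := min ‖(((ζ i).im : AddCircle θ) - ((ζ j).im : AddCircle θ))‖ Real.pi with hm
  set m' := min ‖(((ζ' i).im : AddCircle θ') - ((ζ' j).im : AddCircle θ'))‖ Real.pi with hm'
  have nonneg : ∀ c : ℝ, c ≤ 1 → 0 ≤ Real.exp ρ ^ 2 + Real.exp ρ ^ 2
      - 2 * Real.exp ρ * Real.exp ρ * c := by
    intro c hc
    nlinarith [Real.exp_pos ρ, mul_pos (Real.exp_pos ρ) (Real.exp_pos ρ)]
  rw [Real.sqrt_inj (nonneg _ (Real.cos_le_one _)) (nonneg _ (Real.cos_le_one _))] at e1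
  have hcos : Real.cos m' = Real.cos m := by
    have := mul_pos (Real.exp_pos ρ) (Real.exp_pos ρ)
    apply mul_left_cancel₀ this.ne'
    linarith
  have hmm : m' = m := Real.injOn_cos
    ⟨le_min (norm_nonneg _) Real.pi_pos.le, min_le_right _ _⟩
    ⟨le_min (norm_nonneg _) Real.pi_pos.le, min_le_right _ _⟩ hcos
  have : δ ≤ m := hmm ▸ le_min hd hδpi
  exact this.trans (min_le_left _ _)

theorem HasConeAngle.unique {p : S} {θ θ' : ℝ} (h : HasConeAngle p θ) (h' : HasConeAngle p θ') :
    θ = θ' := by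
  obtain ⟨R, P, hP⟩ := h.exists_isPrePolar
  obtain ⟨R', P', hP'⟩ := h'.exists_isPrePolar
  exact le_antisymm (hP'.angle_le hP) (hP.angle_le hP')

end AngleUniqueness

/-! ### Connectedness of the nonsingular part -/

section Connectedness

/-- The complement of a set of isolated points is connected if small punctured neighbourhoods
are. -/
theorem isPreconnected_of_punctured {X : Type*} [TopologicalSpace X] [T1Space X]
    [PreconnectedSpace X]
    {U : Set X} (hne : ∀ p : X, (𝓝[≠] p).NeBot)
    (hloc : ∀ p, ∃ V ∈ 𝓝 p, V \ {p} ⊆ U ∧ IsPreconnected (V \ {p})) : IsPreconnected U := by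
  rw [isPreconnected_iff_subset_of_disjoint]
  intro A B hA hB hAB hd
  have hUe : ∀ p, ∀ᶠ x in 𝓝[≠] p, x ∈ U := by
    intro p
    obtain ⟨V, hV, hVU, -⟩ := hloc p
    filter_upwards [mem_nhdsWithin_of_mem_nhds hV, self_mem_nhdsWithin] with x h1 h2
    exact hVU ⟨h1, h2⟩
  -- `N A` consists of the points with a punctured neighbourhood in `A`. As the small punctured
  -- neighbourhoods are connected, `N A` and `N B` split the whole space into two disjoint open
  -- sets.
  let N : Set X → Set X := fun A => {p | ∀ᶠ x in 𝓝[≠] p, x ∈ A}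
  have hNo : ∀ A, IsOpen A → IsOpen (N A) := by
    intro A hA
    rw [isOpen_iff_mem_nhds]
    intro p hp
    have h1 : ∀ᶠ x in 𝓝[≠] p, x ∈ N A := by
      filter_upwards [hp] with x hx
      exact mem_nhdsWithin_of_mem_nhds (hA.mem_nhds hx)
    rw [eventually_nhdsWithin_iff] at h1
    filter_upwards [h1] with x hx
    by_cases hxp : x = p
    · rwa [hxp]
    · exact hx hxp
  have hcov : ∀ p, p ∈ N A ∪ N B := by
    intro p
    obtain ⟨V, hV, hVU, hVc⟩ := hloc p
    have hVN : V \ {p} ∈ 𝓝[≠] p :=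
      inter_mem (mem_nhdsWithin_of_mem_nhds hV) self_mem_nhdsWithin
    have hd' : V \ {p} ∩ (A ∩ B) = ∅ :=
      subset_empty_iff.1 (hd ▸ inter_subset_inter_left _ hVU)
    exact (isPreconnected_iff_subset_of_disjoint.1 hVc A B hA hB (hVU.trans hAB) hd').imp
      (fun h => mem_of_superset hVN h) (fun h => mem_of_superset hVN h)
  have hdisj : ∀ p, p ∈ N A → p ∉ N B := by
    intro p (h1 : ∀ᶠ y in 𝓝[≠] p, y ∈ A) (h2 : ∀ᶠ y in 𝓝[≠] p, y ∈ B)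
    have := hne p
    obtain ⟨x, ⟨hx1, hx2⟩, hx3⟩ := ((h1.and h2).and (hUe p)).exists
    have : x ∈ U ∩ (A ∩ B) := ⟨hx3, hx1, hx2⟩
    rwa [hd] at this
  have hfin : ∀ A B : Set X, IsOpen B → U ⊆ A ∪ B → U ∩ (A ∩ B) = ∅ → (∀ p, p ∈ N A) → U ⊆ A := by
    intro A B hB hAB hd hall x hx
    rcases hAB hx with h | h
    · exact h
    · exfalso
      have := hne x
      have hx' : ∀ᶠ y in 𝓝[≠] x, y ∈ A := hall x
      obtain ⟨y, hy1, hy2, hy3⟩ := (hx'.and ((hUe x).and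
        (mem_nhdsWithin_of_mem_nhds (hB.mem_nhds h)))).exists
      have : y ∈ U ∩ (A ∩ B) := ⟨hy2, hy1, hy3⟩
      rwa [hd] at this
  rcases isPreconnected_iff_subset_of_disjoint.1 isPreconnected_univ (N A) (N B) (hNo A hA) (hNo B hB)
    (fun p _ => hcov p) (by
      ext p
      simp only [univ_inter, mem_inter_iff, mem_empty_iff_false, iff_false]
      exact fun h => hdisj p h.1 h.2) with h | h
  · exact Or.inl (hfin A B hB hAB hd fun p => h trivial)
  · exact Or.inr (hfin B A hA (by rwa [union_comm]) (by rwa [inter_comm B A])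
      fun p => h trivial)

theorem IsPrePolar.neBot {p : S} {θ R : ℝ} {P : ℂ → S} (h : IsPrePolar p θ R P) :
    (𝓝[≠] p).NeBot := by
  have : Tendsto (fun r : ℝ => P r) atBot (𝓝[≠] p) := by
    refine tendsto_nhdsWithin_iff.2 ⟨?_, ?_⟩
    · rw [tendsto_iff_dist_tendsto_zero]
      refine Real.tendsto_exp_atBot.congr' ?_
      filter_upwards [eventually_lt_atBot R] with r hr
      rw [h.dist_center _ (by simpa using hr), ofReal_re]
    · filter_upwards [eventually_lt_atBot R] with r hr
      exact h.ne_center (by simpa using hr)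
  exact this.neBot

variable (S) in
theorem isOpen_regular (hS : {p : S | ¬ IsRegularPoint p}.Finite) :
    IsOpen {p : S | IsRegularPoint p} := by
  have := hS.isClosed.isOpen_compl
  simpa [compl_ofPred] using this

theorem IsFlatConeMetric.exists_isPolar (hS : IsFlatConeMetric S) (O : FlatOrientation S) (p : S) :
    ∃ θ R P, 2 * Real.pi ≤ θ ∧ HasConeAngle p θ ∧ IsPolar O p θ R P := by
  obtain ⟨θ, hθ, h⟩ := hS.locally_cone p
  obtain ⟨R, P, hP⟩ := h.exists_isPolar hS.finite_singular O
  exact ⟨θ, R, P, hθ, h, hP⟩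

theorem IsFlatConeMetric.neBot (hS : IsFlatConeMetric S) (p : S) :
    (𝓝[≠] p).NeBot := by
  obtain ⟨θ, -, h⟩ := hS.locally_cone p
  obtain ⟨R, P, hP⟩ := h.exists_isPrePolar
  exact hP.neBot

theorem IsPrePolar.isPreconnected_image {p : S} {θ R : ℝ} {P : ℂ → S} (h : IsPrePolar p θ R P) :
    IsPreconnected (ball p (Real.exp R) \ {p}) := by
  rw [← h.image_half]
  exact (isPreconnected_half R).image _ fun ζ hζ => (h.continuousAt hζ).continuousWithinAt

theorem IsPolar.punctured_subset {O : FlatOrientation S} {p : S} {θ R : ℝ} {P : ℂ → S}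
    (h : IsPolar O p θ R P) : ball p (Real.exp R) \ {p} ⊆ {x | IsRegularPoint x} := by
  rw [← h.image_half]
  rintro _ ⟨ζ, hζ, rfl⟩
  exact h.regular ζ hζ

theorem IsFlatConeMetric.isPreconnected_regular [ConnectedSpace S] (hS : IsFlatConeMetric S)
    (O : FlatOrientation S) : IsPreconnected {p : S | IsRegularPoint p} := by
  refine isPreconnected_of_punctured hS.neBot fun p => ?_
  obtain ⟨θ, R, P, -, -, hP⟩ := hS.exists_isPolar O p
  exact ⟨_, ball_mem_nhds p (Real.exp_pos R), hP.punctured_subset, hP.isPreconnected_image⟩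

end Connectedness

/-! ### Flat coordinate changes and the holonomy around a cone point -/

section Transitions

variable (O : FlatOrientation S)

namespace FlatOrientation

theorem eventually_symm {e : OpenPartialHomeomorph S ℂ} {p : S} (hp : p ∈ e.source)
    {Q : S → Prop} (hQ : ∀ᶠ x in 𝓝 p, Q x) : ∀ᶠ z in 𝓝 (e p), Q (e.symm z) ∧ e (e.symm z) = z := by
  have h1 : Tendsto e.symm (𝓝 (e p)) (𝓝 p) := e.tendsto_symm hp
  exact (h1.eventually hQ).and (e.eventually_right_inverse' hp)

theorem hasDerivAt_transition {e : OpenPartialHomeomorph S ℂ} {g : S → ℂ}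
    {p : S} (hp : p ∈ e.source) {a b : ℂ} (h : ∀ᶠ x in 𝓝 p, g x = a * e x + b) :
    HasDerivAt (g ∘ e.symm) a (e p) := by
  have h2 : HasDerivAt (fun z : ℂ => a * z + b) a (e p) := by
    simpa using ((hasDerivAt_id (e p)).const_mul a).add_const b
  refine h2.congr_of_eventuallyEq ?_
  filter_upwards [eventually_symm hp h] with z hz
  rw [Function.comp, hz.1, hz.2]

/-- Coordinate changes of an oriented flat atlas are motions. -/
theorem exists_transition {e e' : OpenPartialHomeomorph S ℂ} (he : e ∈ O.charts)
    (he' : e' ∈ O.charts) {p : S} (hp : p ∈ e.source) (hp' : p ∈ e'.source) :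
    ∃ (a : Circle) (b : ℂ), (∀ᶠ x in 𝓝 p, e' x = a * e x + b) ∧
      ∀ᶠ x in 𝓝 p, deriv (e' ∘ e.symm) (e x) = a := by
  obtain ⟨a, b, h⟩ := O.compatible e he e' he' p hp hp'
  refine ⟨a, b, h, ?_⟩
  filter_upwards [h.eventually_nhds, e.open_source.mem_nhds hp] with x hx hxs
  exact (hasDerivAt_transition hxs hx).deriv

end FlatOrientation

/-- Going once around a point of cone angle `θ` rotates tangent vectors by the angle `-θ`. -/
theorem IsPolar.exists_hasHolonomy {O : FlatOrientation S} {p : S} {θ R : ℝ} {P : ℂ → S}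
    (h : IsPolar O p θ R P) : ∃ (x : S) (γ : Path x x), O.HasHolonomy γ (Circle.exp (-θ)) := by
  let l : unitInterval → ℂ := fun t => (R - 1 : ℝ) + (t : ℝ) * (θ * I)
  have hl : ∀ t, (l t).re < R := fun t => by simp [l]
  have hlc : Continuous l := by fun_prop
  have hl1 : l 1 = l 0 + θ * I := by simp [l]
  have hP1 : P (l 1) = P (l 0) := by rw [hl1, h.periodic]
  have hPc : Continuous fun t => P (l t) := continuous_iff_continuousAt.2 fun t =>
    (h.continuousAt (hl t)).comp hlc.continuousAt
  let γ : Path (P (l 0)) (P (l 0)) :=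
    { toFun := fun t => P (l t), continuous_toFun := hPc, source' := rfl, target' := hP1 }
  -- The constant vector `1` of the plane with coordinate `exp ζ`: where a chart reads `c * exp ζ +
  -- d`, its component is `c`. After a full turn `ζ` has moved by `θ * I`, which multiplies `exp
  -- (-ζ)` by the holonomy.
  let v : unitInterval → OpenPartialHomeomorph S ℂ → ℂ := fun t e =>
    deriv (fun ζ => e (P ζ)) (l t) * exp (-(l t))
  have hv : ∀ t, ∀ e : OpenPartialHomeomorph S ℂ, ∀ c d : ℂ,
      (∀ᶠ ζ in 𝓝 (l t), e (P ζ) = c * exp ζ + d) → v t e = c := by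
    intro t e c d hcd
    have h1 : HasDerivAt (fun ζ => c * exp ζ + d) (c * exp (l t)) (l t) :=
      ((Complex.hasDerivAt_exp _).const_mul c).add_const d
    have h2 := (h1.congr_of_eventuallyEq hcd).deriv
    simp only [v]
    rw [h2, mul_assoc, ← exp_add, add_neg_cancel, exp_zero, mul_one]
  have hv0 : ∀ t, ∀ e ∈ O.charts, γ t ∈ e.source → v t e ≠ 0 := by
    intro t e he hs
    obtain ⟨c, d, hcd⟩ := h.motion (l t) (hl t) e he hs
    rw [hv t e c d hcd]
    exact c.coe_ne_zero
  refine ⟨P (l 0), γ, fun t => h.regular _ (hl t), v, ⟨?_, ?_⟩, ?_⟩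
  · intro t e he e' he' hs hs'
    obtain ⟨c, d, hcd⟩ := h.motion (l t) (hl t) e he hs
    obtain ⟨a, b, hab, hder⟩ := O.exists_transition he he' hs hs'
    rw [hder.self_of_nhds, hv t e c d hcd]
    refine hv t e' (a * c) (a * d + b) ?_
    filter_upwards [hcd, (h.continuousAt (hl t)).eventually hab] with ζ h1 h2
    rw [h2, h1]; ring
  · intro t e he hs
    obtain ⟨c, d, hcd⟩ := h.motion (l t) (hl t) e he hs
    filter_upwards [hlc.continuousAt.eventually hcd.eventually_nhds] with s hs
    rw [hv s e c d hs, hv t e c d hcd]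
  · obtain ⟨e, he, hs⟩ := O.covers _ (h.regular _ (hl 0))
    refine ⟨e, he, hs, hv0 0 e he hs, ?_⟩
    obtain ⟨c, d, hcd⟩ := h.motion (l 0) (hl 0) e he hs
    simp only [v]
    have hder : deriv (fun ζ => e (P ζ)) (l 1) = deriv (fun ζ => e (P ζ)) (l 0) := by
      have := deriv_comp_add_const (fun ζ => e (P ζ)) (θ * I) (l 0)
      simp only [h.periodic] at this
      rw [hl1, this]
    rw [hder, hl1, Circle.coe_exp, neg_add, exp_add]
    push_cast
    ring_nf

end Transitions

/-! ### Holomorphic coordinates and zeros of quadratic differentials -/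

section Manifold

variable {X : Type*} [TopologicalSpace X]

theorem mem_contDiffGroupoid_of_analyticOn {f : OpenPartialHomeomorph ℂ ℂ}
    (h1 : ∀ z ∈ f.source, AnalyticAt ℂ f z) (h2 : ∀ z ∈ f.target, AnalyticAt ℂ f.symm z) :
    f ∈ contDiffGroupoid ω 𝓘(ℂ) := by
  rw [contDiffGroupoid, mem_groupoid_of_pregroupoid]
  simp only [contDiffPregroupoid, modelWithCornersSelf_coe, modelWithCornersSelf_coe_symm,
    Function.comp_id, Function.id_comp, preimage_id, range_id, inter_univ]
  exact ⟨fun z hz => (h1 z hz).contDiffAt.contDiffWithinAt,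
    fun z hz => (h2 z hz).contDiffAt.contDiffWithinAt⟩

theorem analyticAt_of_mem_contDiffGroupoid {f : OpenPartialHomeomorph ℂ ℂ}
    (hf : f ∈ contDiffGroupoid ω 𝓘(ℂ)) {z : ℂ} (hz : z ∈ f.source) : AnalyticAt ℂ f z := by
  rw [contDiffGroupoid, mem_groupoid_of_pregroupoid] at hf
  simp only [contDiffPregroupoid, modelWithCornersSelf_coe, modelWithCornersSelf_coe_symm,
    Function.comp_id, Function.id_comp, preimage_id, range_id, inter_univ] at hf
  exact (hf.1.contDiffAt (f.open_source.mem_nhds hz)).analyticAt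

theorem OpenPartialHomeomorph.mem_source_symm_trans {e e' : OpenPartialHomeomorph X ℂ} {x : X}
    (hx : x ∈ e.source) (hx' : x ∈ e'.source) : e x ∈ (e.symm.trans e').source := by
  simp [hx, hx']

variable [ChartedSpace ℂ X]

theorem analyticAt_transition {φ ψ : OpenPartialHomeomorph X ℂ}
    (hφ : φ ∈ IsManifold.maximalAtlas 𝓘(ℂ) ω X) (hψ : ψ ∈ IsManifold.maximalAtlas 𝓘(ℂ) ω X) {x : X}
    (hx : x ∈ φ.source) (hx' : x ∈ ψ.source) : AnalyticAt ℂ (ψ ∘ φ.symm) (φ x) :=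
  analyticAt_of_mem_contDiffGroupoid (IsManifold.compatible_of_mem_maximalAtlas hφ hψ)
    (OpenPartialHomeomorph.mem_source_symm_trans hx hx')

namespace HolomorphicQuadraticDifferential

variable [IsManifold 𝓘(ℂ) ω X] (q : HolomorphicQuadraticDifferential X)

theorem nonzeroAt_iff {φ : OpenPartialHomeomorph X ℂ}
    (hφ : φ ∈ IsManifold.maximalAtlas 𝓘(ℂ) ω X) {p : X} (hp : p ∈ φ.source) :
    q.NonzeroAt p ↔ q.coeff φ (φ p) ≠ 0 := by
  have hc := IsManifold.chart_mem_maximalAtlas (I := 𝓘(ℂ)) (n := ω) (M := X) p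
  have hp' := mem_chart_source ℂ p
  unfold NonzeroAt
  constructor
  · intro h h0
    apply h
    rw [q.transform _ hc _ hφ p hp' hp, h0, zero_mul]
  · intro h h0
    apply h
    rw [q.transform _ hφ _ hc p hp hp', h0, zero_mul]

/-- The zeros of a nonzero holomorphic quadratic differential are isolated. -/
theorem eventually_nonzeroAt [PreconnectedSpace X] (hq : ∃ p, q.NonzeroAt p) (p : X) :
    ∀ᶠ x in 𝓝[≠] p, q.NonzeroAt x := by
  have dich : ∀ p, (∀ᶠ x in 𝓝 p, ¬ q.NonzeroAt x) ∨ ∀ᶠ x in 𝓝[≠] p, q.NonzeroAt x := by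
    intro p
    let φ := chartAt ℂ p
    have hφ : φ ∈ IsManifold.maximalAtlas 𝓘(ℂ) ω X := IsManifold.chart_mem_maximalAtlas p
    have hp : p ∈ φ.source := mem_chart_source ℂ p
    have han : AnalyticAt ℂ (q.coeff φ) (φ p) :=
      (q.holomorphic φ hφ).analyticAt (φ.open_target.mem_nhds (φ.map_source hp))
    have hc : Tendsto φ (𝓝 p) (𝓝 (φ p)) := φ.continuousAt hp
    refine han.eventually_eq_zero_or_eventually_ne_zero.imp (fun h => ?_) (fun h => ?_)
    · filter_upwards [hc.eventually h, φ.open_source.mem_nhds hp] with x h1 h2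
      rw [q.nonzeroAt_iff hφ h2, not_not]
      exact h1
    · rw [eventually_nhdsWithin_iff] at h ⊢
      filter_upwards [hc.eventually h, φ.open_source.mem_nhds hp] with x h1 h2 h3
      rw [q.nonzeroAt_iff hφ h2]
      exact h1 fun he => h3 (φ.injOn h2 hp he)
  -- The set of points near which `q` vanishes identically is open, and by the dichotomy also
  -- closed. It is not everything, so it is empty.
  let A : Set X := {p | ∀ᶠ x in 𝓝 p, ¬ q.NonzeroAt x}
  have hA : IsOpen A := isOpen_iff_mem_nhds.2 fun p (hp : ∀ᶠ x in 𝓝 p, ¬ q.NonzeroAt x) =>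
    hp.eventually_nhds
  have hAc : IsOpen Aᶜ := by
    rw [isOpen_iff_mem_nhds]
    intro p hp
    have h := (dich p).resolve_left hp
    rw [eventually_nhdsWithin_iff] at h
    filter_upwards [h] with x hx
    by_cases hxp : x = p
    · rwa [hxp]
    · exact fun hxA => (hxA : ∀ᶠ y in 𝓝 x, ¬ q.NonzeroAt y).self_of_nhds (hx hxp)
  rcases isClopen_iff.1 ⟨⟨hAc⟩, hA⟩ with h | h
  · exact (dich p).resolve_left fun hp => (h ▸ hp : p ∈ (∅ : Set X))
  · obtain ⟨p₀, hp₀⟩ := hq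
    have : p₀ ∈ A := h ▸ mem_univ p₀
    exact absurd hp₀ (this : ∀ᶠ y in 𝓝 p₀, ¬ q.NonzeroAt y).self_of_nhds

end HolomorphicQuadraticDifferential

end Manifold

/-! ### From a quadratic differential to holonomy and cone angles -/

section Metric

variable {S : Type*} [MetricSpace S] {O : FlatOrientation S} [ChartedSpace ℂ S]
  [IsManifold 𝓘(ℂ) ω S] {q : HolomorphicQuadraticDifferential S}

/-- Near `p`, but off `p`, there are natural coordinates, and they are motions in terms of the flat
chart `e`. So the coefficient of `q` in `e` has absolute value 1 there, which is the identity in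
`key`. The map `h` is holomorphic across `e p` by removable singularities, and the identity passes
to the limit, which excludes a zero at `p`. -/
theorem IsMetricOf.nonzeroAt_of_isRegularPoint [ConnectedSpace S] (hq : IsMetricOf O q) {p : S}
    [(𝓝[≠] p).NeBot] (hp : IsRegularPoint p) : q.NonzeroAt p := by
  obtain ⟨e, he, hpe⟩ := O.covers p hp
  let φ := chartAt ℂ p
  have hφ : φ ∈ IsManifold.maximalAtlas 𝓘(ℂ) ω S := IsManifold.chart_mem_maximalAtlas p
  have hpφ : p ∈ φ.source := mem_chart_source ℂ p
  let h : ℂ → ℂ := φ ∘ e.symm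
  have key : ∀ᶠ z in 𝓝[≠] (e p), DifferentiableAt ℂ h z ∧
      ‖q.coeff φ (h z)‖ * ‖deriv h z‖ ^ 2 = 1 := by
    have h1 := q.eventually_nonzeroAt hq.1 p
    rw [eventually_nhdsWithin_iff] at h1 ⊢
    filter_upwards [FlatOrientation.eventually_symm hpe h1, FlatOrientation.eventually_symm hpe
      (φ.open_source.mem_nhds hpφ), e.open_target.mem_nhds (e.map_source hpe)] with z hz1 hz2 hzt hzp
    set x := e.symm z with hx
    have hxe : x ∈ e.source := e.map_target hzt
    have hzx : e x = z := hz1.2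
    have hxp : x ≠ p := by
      intro hxp
      apply hzp
      rw [← hzx, hxp]; rfl
    obtain ⟨ξ, hxξ, ⟨hξ, hξ1⟩, -, hor⟩ := hq.2 x (hz1.1 hxp)
    obtain ⟨a, b, hab⟩ := hor e he x hxe hxξ
    have hτ := (analyticAt_transition hξ hφ hxξ hz2.1).differentiableAt.hasDerivAt
    have hξe : HasDerivAt (ξ ∘ e.symm) a (e x) := FlatOrientation.hasDerivAt_transition hxe hab
    have hcomp : HasDerivAt ((φ ∘ ξ.symm) ∘ (ξ ∘ e.symm)) (deriv (φ ∘ ξ.symm) (ξ x) * a) (e x) := by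
      refine HasDerivAt.comp (e x) ?_ hξe
      simpa [e.left_inv hxe] using hτ
    have hh : HasDerivAt h (deriv (φ ∘ ξ.symm) (ξ x) * a) (e x) := by
      refine hcomp.congr_of_eventuallyEq ?_
      filter_upwards [FlatOrientation.eventually_symm hxe (ξ.open_source.mem_nhds hxξ)] with w hw
      simp [h, ξ.left_inv hw.1]
    have htr := q.transform ξ hξ φ hφ x hxξ hz2.1
    rw [hξ1 _ (ξ.map_source hxξ)] at htr
    rw [← hzx]
    refine ⟨hh.differentiableAt, ?_⟩
    rw [hh.deriv]
    have hhx : h (e x) = φ x := by simp [h, e.left_inv hxe]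
    have := congrArg norm htr
    rw [hhx, norm_mul, a.norm_coe, mul_one, ← norm_pow, ← norm_mul, ← this, norm_one]
  have hhc : ContinuousAt h (e p) := by
    refine ContinuousAt.comp ?_ (e.continuousAt_symm (e.map_source hpe))
    rw [e.left_inv hpe]
    exact φ.continuousAt hpφ
  have hhp : h (e p) = φ p := by simp [h, e.left_inv hpe]
  have han : AnalyticAt ℂ h (e p) :=
    Complex.analyticAt_of_differentiable_on_punctured_nhds_of_continuousAt
      (key.mono fun z hz => hz.1) hhc
  have hcoeff : ContinuousAt (q.coeff φ) (h (e p)) := by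
    rw [hhp]
    exact ((q.holomorphic φ hφ).continuousOn).continuousAt (φ.open_target.mem_nhds (φ.map_source hpφ))
  have hcont : ContinuousAt (fun z => ‖q.coeff φ (h z)‖ * ‖deriv h z‖ ^ 2) (e p) :=
    ((hcoeff.comp hhc).norm).mul (han.deriv.continuousAt.norm.pow 2)
  have hlim : Tendsto (fun z => ‖q.coeff φ (h z)‖ * ‖deriv h z‖ ^ 2) (𝓝[≠] (e p)) (𝓝 1) :=
    tendsto_const_nhds.congr' (key.mono fun z hz => hz.2.symm)
  have heq := tendsto_nhds_unique (hcont.tendsto.mono_left nhdsWithin_le_nhds) hlim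
  rw [q.nonzeroAt_iff hφ hpφ, ← hhp]
  intro h0
  simp [h0] at heq

omit [IsManifold 𝓘(ℂ) ω S] in
-- Both coordinates express the same form, `dξ² = dξ'²`; in terms of `g` the two sides are `a² dg²`
-- and `a'² dg²`.
theorem HolomorphicQuadraticDifferential.IsNaturalCoordinate.sq_eq_sq
    {ξ ξ' : OpenPartialHomeomorph S ℂ} (h : q.IsNaturalCoordinate ξ)
    (h' : q.IsNaturalCoordinate ξ') {x : S} (hx : x ∈ ξ.source) (hx' : x ∈ ξ'.source)
    {g : S → ℂ} {a b a' b' : ℂ} (ha : a ≠ 0)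
    (hg : ∀ᶠ y in 𝓝 x, ξ y = a * g y + b) (hg' : ∀ᶠ y in 𝓝 x, ξ' y = a' * g y + b') :
    a ^ 2 = a' ^ 2 := by
  have htr := q.transform ξ h.1 ξ' h'.1 x hx hx'
  have hd : HasDerivAt (ξ' ∘ ξ.symm) (a' / a) (ξ x) := by
    refine FlatOrientation.hasDerivAt_transition (b := b' - a' * b / a) hx ?_
    filter_upwards [hg, hg'] with y h1 h2
    rw [h1, h2]; field_simp; ring
  rw [h.2 _ (ξ.map_source hx), h'.2 _ (ξ'.map_source hx'), hd.deriv, one_mul] at htr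
  field_simp at htr
  exact htr

/-- A holomorphic quadratic differential is preserved by parallel transport up to sign. -/
theorem IsMetricOf.holonomy_sq [ConnectedSpace S] (hS : IsFlatConeMetric S) (hq : IsMetricOf O q)
    {p : S} {γ : Path p p} {h : Circle} (hγ : O.HasHolonomy γ h) : h ^ 2 = 1 := by
  obtain ⟨hreg, v, hv, e₀, he₀, hp₀, hv0, hv1⟩ := hγ
  -- `K t κ` says that `κ` is the value of `q` on the vector `v t`, computed with some flat chart
  -- and some natural coordinate. Independence of these choices makes it a function of `t`, and this
  -- function is locally constant.
  let K : unitInterval → ℂ → Prop := fun t κ => ∃ e ∈ O.charts, ∃ ξ : OpenPartialHomeomorph S ℂ,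
    γ t ∈ e.source ∧ γ t ∈ ξ.source ∧ q.IsNaturalCoordinate ξ ∧ ∃ (a : Circle) (b : ℂ),
      (∀ᶠ y in 𝓝 (γ t), ξ y = a * e y + b) ∧ κ = (a * v t e) ^ 2
  have hex : ∀ t, ∀ e ∈ O.charts, γ t ∈ e.source → ∃ ξ : OpenPartialHomeomorph S ℂ,
      γ t ∈ ξ.source ∧ q.IsNaturalCoordinate ξ ∧ ∃ (a : Circle) (b : ℂ),
        ∀ᶠ y in 𝓝 (γ t), ξ y = a * e y + b := by
    intro t e he hs
    have := hS.neBot (γ t)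
    obtain ⟨ξ, hxξ, hnat, -, hor⟩ := hq.2 (γ t) (hq.nonzeroAt_of_isRegularPoint (hreg t))
    exact ⟨ξ, hxξ, hnat, hor e he _ hs hxξ⟩
  have huniq : ∀ t κ κ', K t κ → K t κ' → κ = κ' := by
    rintro t κ κ' ⟨e, he, ξ, hs, hξs, hξ, a, b, hab, rfl⟩ ⟨e', he', ξ', hs', hξs', hξ', a', b', hab', rfl⟩
    obtain ⟨c, d, hcd, hder⟩ := O.exists_transition he he' hs hs'
    rw [hv.change_of_chart t e he e' he' hs hs', hder.self_of_nhds]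
    have := hξ.sq_eq_sq hξ' hξs hξs' (g := e) (a' := a' * c) (b' := a' * d + b') a.coe_ne_zero hab (by
      filter_upwards [hcd, hab'] with y h1 h2
      rw [h2, h1]; ring)
    rw [mul_pow, this]; ring
  have htot : ∀ t, ∃ κ, K t κ := by
    intro t
    obtain ⟨e, he, hs⟩ := O.covers _ (hreg t)
    obtain ⟨ξ, hξs, hξ, a, b, hab⟩ := hex t e he hs
    exact ⟨_, e, he, ξ, hs, hξs, hξ, a, b, hab, rfl⟩
  choose κ hκ using htot
  have hloc : IsLocallyConstant κ := by
    rw [IsLocallyConstant.iff_eventually_eq]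
    intro t
    obtain ⟨e, he, ξ, hs, hξs, hξ, a, b, hab, hk⟩ := hκ t
    have hγc : Tendsto γ (𝓝 t) (𝓝 (γ t)) := γ.continuous.continuousAt
    filter_upwards [hγc.eventually (e.open_source.mem_nhds hs),
      hγc.eventually (ξ.open_source.mem_nhds hξs), hγc.eventually hab.eventually_nhds,
      hv.locally_constant t e he hs] with s h1 h2 h3 h4
    exact huniq s _ _ (hκ s) ⟨e, he, ξ, h1, h2, hξ, a, b, h3, by rw [hk, h4]⟩
  have h01 : κ 0 = κ 1 := hloc.apply_eq_of_isPreconnected isPreconnected_univ trivial trivial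
  have hs0 : γ 0 ∈ e₀.source := by rwa [γ.source]
  obtain ⟨ξ, hξs, hξ, a, b, hab⟩ := hex 0 e₀ he₀ hs0
  have e0 : κ 0 = (a * v 0 e₀) ^ 2 :=
    huniq 0 _ _ (hκ 0) ⟨e₀, he₀, ξ, hs0, hξs, hξ, a, b, hab, rfl⟩
  have e1 : κ 1 = (a * v 1 e₀) ^ 2 := by
    rw [γ.source] at hξs hab
    exact huniq 1 _ _ (hκ 1) ⟨e₀, he₀, ξ, by rwa [γ.target], by rwa [γ.target], hξ, a, b,
      by rwa [γ.target], rfl⟩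
  rw [e0, e1, hv1] at h01
  have ha := a.coe_ne_zero
  apply Circle.ext
  rw [Circle.coe_pow, Circle.coe_one]
  have h2 : ((a : ℂ) * v 0 e₀) ^ 2 ≠ 0 := pow_ne_zero 2 (mul_ne_zero ha hv0)
  apply mul_right_cancel₀ h2
  rw [one_mul]
  linear_combination -h01

end Metric

theorem coe_eq_one_or_neg_one_of_mem_holonomyGroup {S : Type*} [MetricSpace S]
    {O : FlatOrientation S}
    (hO : ∀ (p : S) (γ : Path p p) (h : Circle), O.HasHolonomy γ h → h ^ 2 = 1) {h : Circle}
    (hh : h ∈ O.holonomyGroup) : (h : ℂ) = 1 ∨ (h : ℂ) = -1 := by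
  have h2 : h ^ 2 = 1 := by
    induction hh using Subgroup.closure_induction with
    | mem x hx => obtain ⟨p, γ, hγ⟩ := hx; exact hO p γ x hγ
    | one => simp
    | mul x y _ _ hx hy => rw [mul_pow, hx, hy, one_mul]
    | inv x _ hx => rw [inv_pow, hx, inv_one]
  rw [← sq_eq_one_iff]
  exact_mod_cast congrArg (fun z : Circle => (z : ℂ)) h2

/-- The circle around `p` has holonomy `exp (-iθ)`, whose square must be 1. Uniqueness of the cone
angle identifies `θ` with the angle of the available polar coordinates, which is at least `2π`. -/
theorem coneAngle_of_holonomy {S : Type*} [MetricSpace S] {O : FlatOrientation S}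
    (hS : IsFlatConeMetric S)
    (hO : ∀ (p : S) (γ : Path p p) (h : Circle), O.HasHolonomy γ h → h ^ 2 = 1)
    {p : S} {θ : ℝ} (hθ : HasConeAngle p θ) (hne : θ ≠ 2 * Real.pi) :
    ∃ k : ℤ, 3 ≤ k ∧ θ = k * Real.pi := by
  obtain ⟨θ', R, P, hθ', h', hP⟩ := hS.exists_isPolar O p
  obtain rfl := hθ.unique h'
  obtain ⟨x, γ, hγ⟩ := hP.exists_hasHolonomy
  have h2 := hO x γ _ hγ
  have h3 : Circle.exp (-(2 * θ)) = 1 := by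
    rw [← h2, ← Circle.exp_nsmul]
    congr 1; simp
  rw [Circle.exp_eq_one] at h3
  obtain ⟨n, hn⟩ := h3
  have hpi := Real.pi_pos
  have hk : θ = ((-n : ℤ) : ℝ) * Real.pi := by push_cast; linarith
  refine ⟨-n, ?_, hk⟩
  have h4 : 2 * Real.pi < θ := lt_of_le_of_ne hθ' hne.symm
  rw [hk] at h4
  have : (2 : ℝ) < ((-n : ℤ) : ℝ) := lt_of_mul_lt_mul_right h4 hpi.le
  have : (2 : ℤ) < -n := by exact_mod_cast this
  omega

theorem ComesFromQuadraticDifferential.conditions {S : Type*} [MetricSpace S] [ConnectedSpace S]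
    (hS : IsFlatConeMetric S) {O : FlatOrientation S} (h : ComesFromQuadraticDifferential O) :
    (∀ (p : S) (θ : ℝ), HasConeAngle p θ → θ ≠ 2 * Real.pi →
      ∃ k : ℤ, 3 ≤ k ∧ θ = k * Real.pi) ∧
    ∀ h ∈ O.holonomyGroup, (h : ℂ) = 1 ∨ (h : ℂ) = -1 := by
  obtain ⟨_, _, q, hq⟩ := h
  have hO : ∀ (p : S) (γ : Path p p) (h : Circle), O.HasHolonomy γ h → h ^ 2 = 1 :=
    fun p γ h hγ => hq.holonomy_sq hS hγ
  exact ⟨fun p θ hθ hne => coneAngle_of_holonomy hS hO hθ hne,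
    fun h hh => coe_eq_one_or_neg_one_of_mem_holonomyGroup hO hh⟩

/-! ### Parallel transport and parallel quadratic forms -/

namespace FlatOrientation

variable (O : FlatOrientation S)

/-- The coordinates of a unit tangent vector at `p` in the oriented flat charts. -/
structure IsUnitVector (p : S) (z : OpenPartialHomeomorph S ℂ → ℂ) : Prop where
  change_of_chart : ∀ e ∈ O.charts, ∀ e' ∈ O.charts, p ∈ e.source → p ∈ e'.source →
    z e' = deriv (e' ∘ e.symm) (e p) * z e
  norm_eq_one : ∀ e ∈ O.charts, p ∈ e.source → ‖z e‖ = 1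

/-- Parallel transport along some path in the nonsingular part takes `z` to `w`. -/
def Transports (p q : S) (z w : OpenPartialHomeomorph S ℂ → ℂ) : Prop :=
  ∃ (γ : Path p q) (v : unitInterval → OpenPartialHomeomorph S ℂ → ℂ),
    (∀ t, IsRegularPoint (γ t)) ∧ O.IsParallelAlong γ v ∧ (∀ t, O.IsUnitVector (γ t) (v t)) ∧
    (∀ e ∈ O.charts, p ∈ e.source → v 0 e = z e) ∧ (∀ e ∈ O.charts, q ∈ e.source → v 1 e = w e)

variable {O}

theorem IsUnitVector.congr {p : S} {z z' : OpenPartialHomeomorph S ℂ → ℂ}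
    (hz : O.IsUnitVector p z) (h : ∀ e ∈ O.charts, p ∈ e.source → z e = z' e) :
    O.IsUnitVector p z' where
  change_of_chart e he e' he' hp hp' := by
    rw [← h e he hp, ← h e' he' hp', hz.change_of_chart e he e' he' hp hp']
  norm_eq_one e he hp := by rw [← h e he hp, hz.norm_eq_one e he hp]

theorem Transports.right {p q : S} {z w : OpenPartialHomeomorph S ℂ → ℂ}
    (h : O.Transports p q z w) : O.IsUnitVector q w := by
  obtain ⟨γ, v, -, -, hu, -, h1⟩ := h
  have := hu 1
  rw [γ.target] at this
  exact this.congr h1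

theorem Transports.left {p q : S} {z w : OpenPartialHomeomorph S ℂ → ℂ}
    (h : O.Transports p q z w) : O.IsUnitVector p z := by
  obtain ⟨γ, v, -, -, hu, h0, -⟩ := h
  have := hu 0
  rw [γ.source] at this
  exact this.congr h0

theorem Transports.symm {p q : S} {z w : OpenPartialHomeomorph S ℂ → ℂ}
    (h : O.Transports p q z w) : O.Transports q p w z := by
  obtain ⟨γ, v, hr, hv, hu, h0, h1⟩ := h
  refine ⟨γ.symm, fun t => v (unitInterval.symm t), fun t => hr _, ⟨?_, ?_⟩, fun t => hu _, ?_, ?_⟩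
  · exact fun t => hv.change_of_chart _
  · intro t e he hs
    exact unitInterval.continuous_symm.continuousAt.eventually (hv.locally_constant _ e he hs)
  · simpa using h1
  · simpa using h0

theorem Transports.trans {p q r : S} {z w u : OpenPartialHomeomorph S ℂ → ℂ}
    (h : O.Transports p q z w) (h' : O.Transports q r w u) : O.Transports p r z u := by
  obtain ⟨γ, v, hr, hv, hu, h0, h1⟩ := h
  obtain ⟨γ', v', hr', hv', hu', h0', h1'⟩ := h'
  -- The two reparametrizations are clamped to the unit interval, so they are continuous everywhere
  -- and constant on the half they do not serve.
  let a : unitInterval → unitInterval := fun t => projIcc 0 1 zero_le_one (2 * (t : ℝ))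
  let b : unitInterval → unitInterval := fun t => projIcc 0 1 zero_le_one (2 * (t : ℝ) - 1)
  have ha : Continuous a := continuous_projIcc.comp (by fun_prop)
  have hb : Continuous b := continuous_projIcc.comp (by fun_prop)
  have ha1 : ∀ t : unitInterval, 1 / 2 ≤ (t : ℝ) → a t = 1 := fun t ht =>
    projIcc_of_right_le _ (by linarith)
  have hb0 : ∀ t : unitInterval, (t : ℝ) ≤ 1 / 2 → b t = 0 := fun t ht =>
    projIcc_of_le_left _ (by linarith)
  have htr : ∀ t : unitInterval, (γ.trans γ') t = if (t : ℝ) ≤ 1 / 2 then γ (a t) else γ' (b t) := by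
    intro t
    rw [Path.trans_apply]
    split_ifs with ht
    · congr 1
      exact (projIcc_of_mem _ ⟨by linarith [t.2.1], by linarith⟩).symm
    · congr 1
      exact (projIcc_of_mem _ ⟨by linarith, by linarith [t.2.2]⟩).symm
  have htr1 : ∀ t : unitInterval, (t : ℝ) ≤ 1 / 2 → (γ.trans γ') t = γ (a t) := fun t ht => by
    rw [htr, if_pos ht]
  have htr2 : ∀ t : unitInterval, 1 / 2 ≤ (t : ℝ) → (γ.trans γ') t = γ' (b t) := fun t ht => by
    rw [htr]
    split_ifs with h
    · rw [ha1 t ht, hb0 t h, γ.target, γ'.source]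
    · rfl
  let V : unitInterval → OpenPartialHomeomorph S ℂ → ℂ := fun t e =>
    if (t : ℝ) ≤ 1 / 2 then v (a t) e else v' (b t) e
  have hV1 : ∀ t : unitInterval, (t : ℝ) ≤ 1 / 2 → V t = v (a t) := fun t ht => by
    ext e; simp only [V, if_pos ht]
  -- At `t = 1 / 2` the two fields agree only in charts around the common point, since components in
  -- other charts carry no meaning.
  have hV2 : ∀ t : unitInterval, 1 / 2 ≤ (t : ℝ) → ∀ e ∈ O.charts, (γ.trans γ') t ∈ e.source →
      V t e = v' (b t) e := by
    intro t ht e he hs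
    rcases lt_or_eq_of_le ht with h | h
    · simp only [V, if_neg (not_le.2 h)]
    · rw [hV1 t h.ge, ha1 t ht, hb0 t h.ge]
      rw [htr2 t ht, hb0 t h.ge, γ'.source] at hs
      rw [h1 e he hs, h0' e he hs]
  have hUV : ∀ t, O.IsUnitVector ((γ.trans γ') t) (V t) := by
    intro t
    rcases le_total (t : ℝ) (1 / 2) with ht | ht
    · rw [htr1 t ht, hV1 t ht]; exact hu _
    · refine IsUnitVector.congr (z := v' (b t)) ?_ fun e he hs => (hV2 t ht e he hs).symm
      rw [htr2 t ht]; exact hu' _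
  refine ⟨γ.trans γ', V, ?_, ⟨fun t => (hUV t).change_of_chart, ?_⟩, hUV, ?_, ?_⟩
  · intro t
    rw [htr]
    split_ifs
    · exact hr _
    · exact hr' _
  · intro t e he hs
    have hev : ∀ᶠ s in 𝓝 t, (γ.trans γ') s ∈ e.source :=
      (γ.trans γ').continuous.continuousAt.eventually (e.open_source.mem_nhds hs)
    have left : (t : ℝ) ≤ 1 / 2 → ∀ᶠ s : unitInterval in 𝓝 t, (s : ℝ) ≤ 1 / 2 → V s e = V t e := by
      intro ht
      have hs' := hs
      rw [htr1 t ht] at hs'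
      filter_upwards [ha.continuousAt.eventually (hv.locally_constant _ e he hs')] with s h2 h3
      rw [hV1 s h3, hV1 t ht, h2]
    have right : 1 / 2 ≤ (t : ℝ) → ∀ᶠ s : unitInterval in 𝓝 t, 1 / 2 ≤ (s : ℝ) → V s e = V t e := by
      intro ht
      have hs' := hs
      rw [htr2 t ht] at hs'
      filter_upwards [hb.continuousAt.eventually (hv'.locally_constant _ e he hs'), hev]
        with s h2 h3 h4
      rw [hV2 s h4 e he h3, hV2 t ht e he hs, h2]
    have hcoe : ContinuousAt (fun s : unitInterval => (s : ℝ)) t :=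
      continuous_subtype_val.continuousAt
    rcases lt_trichotomy (t : ℝ) (1 / 2) with ht | ht | ht
    · filter_upwards [left ht.le, hcoe.eventually (gt_mem_nhds ht)] with s h2 h3
      exact h2 h3.le
    · filter_upwards [left ht.le, right ht.ge] with s h2 h3
      exact (le_total (s : ℝ) (1 / 2)).elim h2 h3
    · filter_upwards [right ht.le, hcoe.eventually (lt_mem_nhds ht)] with s h2 h3
      exact h2 h3.le
  · intro e he hs
    have h00 : ((0 : unitInterval) : ℝ) ≤ 1 / 2 := by norm_num
    have : a 0 = 0 := projIcc_of_le_left _ (by simp)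
    rw [hV1 0 h00, this, h0 e he hs]
  · intro e he hs
    have h11 : 1 / 2 ≤ ((1 : unitInterval) : ℝ) := by norm_num
    have : b 1 = 1 := projIcc_of_right_le _ (by norm_num)
    rw [hV2 1 h11 e he (by simpa using hs), this, h1' e he hs]

theorem IsUnitVector.extend {e : OpenPartialHomeomorph S ℂ} (he : e ∈ O.charts) {x : S}
    (hx : x ∈ e.source) {u : ℂ} (hu : ‖u‖ = 1) :
    O.IsUnitVector x (fun e' => deriv (e' ∘ e.symm) (e x) * u) where
  change_of_chart e₁ he₁ e₂ he₂ hx₁ hx₂ := by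
    obtain ⟨a, b, hab, h1⟩ := O.exists_transition he he₁ hx hx₁
    obtain ⟨c, d, hcd, h2⟩ := O.exists_transition he₁ he₂ hx₁ hx₂
    have h3 : HasDerivAt (e₂ ∘ e.symm) (c * a) (e x) := by
      refine hasDerivAt_transition (b := c * b + d) hx ?_
      filter_upwards [hab, hcd] with y h3 h4
      rw [h4, h3]; ring
    rw [h3.deriv, h1.self_of_nhds, h2.self_of_nhds]; ring
  norm_eq_one e₁ he₁ hx₁ := by
    obtain ⟨a, b, hab, h1⟩ := O.exists_transition he he₁ hx hx₁
    rw [h1.self_of_nhds, norm_mul, a.norm_coe, one_mul, hu]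

theorem deriv_self {e : OpenPartialHomeomorph S ℂ} {x : S} (hx : x ∈ e.source) :
    deriv (e ∘ e.symm) (e x) = 1 :=
  (hasDerivAt_transition (b := 0) hx (Eventually.of_forall fun y => by simp)).deriv

/-- Parallel transport inside a small disc does not change the coordinates. -/
theorem exists_nhds_transports (hU : IsOpen {p : S | IsRegularPoint p}) {p : S}
    (hp : IsRegularPoint p) {e : OpenPartialHomeomorph S ℂ} (he : e ∈ O.charts)
    (hpe : p ∈ e.source) : ∃ V ∈ 𝓝 p, V ⊆ e.source ∧ ∀ x ∈ V, ∀ y ∈ V, ∀ z, O.IsUnitVector x z →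
      O.Transports x y z (fun e' => deriv (e' ∘ e.symm) (e y) * z e) := by
  have hev : ∀ᶠ w in 𝓝 (e p), w ∈ e.target ∧ IsRegularPoint (e.symm w) :=
    Filter.Eventually.and (e.open_target.mem_nhds (e.map_source hpe))
      ((e.tendsto_symm hpe).eventually (hU.mem_nhds hp))
  obtain ⟨ρ, hρ, hb⟩ := Metric.eventually_nhds_iff_ball.1 hev
  refine ⟨e.source ∩ e ⁻¹' ball (e p) ρ, inter_mem (e.open_source.mem_nhds hpe)
    (e.continuousAt hpe (ball_mem_nhds _ hρ)), inter_subset_left, ?_⟩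
  rintro x ⟨hx, hxb⟩ y ⟨hy, hyb⟩ z hz
  -- The path is a straight segment in the chart `e`, and a vector with constant component in `e` is
  -- parallel along it.
  let l : unitInterval → ℂ := fun t => AffineMap.lineMap (e x) (e y) (t : ℝ)
  have hlc : Continuous l := AffineMap.lineMap_continuous.comp continuous_subtype_val
  have hl : ∀ t, l t ∈ ball (e p) ρ := fun t =>
    (convex_ball (e p) ρ).lineMap_mem hxb hyb t.2
  let γ : Path x y :=
    { toFun := fun t => e.symm (l t)
      continuous_toFun := continuous_iff_continuousAt.2 fun t =>
        (e.continuousAt_symm (hb _ (hl t)).1).comp hlc.continuousAt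
      source' := by simp [l, e.left_inv hx]
      target' := by simp [l, e.left_inv hy] }
  have hγe : ∀ t, γ t ∈ e.source := fun t => e.map_target (hb _ (hl t)).1
  have hun : ∀ t, O.IsUnitVector (γ t) (fun e' => deriv (e' ∘ e.symm) (e (γ t)) * z e) :=
    fun t => IsUnitVector.extend he (hγe t) (hz.norm_eq_one e he hx)
  refine ⟨γ, fun t e' => deriv (e' ∘ e.symm) (e (γ t)) * z e, fun t => (hb _ (hl t)).2,
    ⟨fun t => (hun t).change_of_chart, ?_⟩, hun, ?_, ?_⟩
  · intro t e' he' hs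
    obtain ⟨a, b, hab, h1⟩ := O.exists_transition he he' (hγe t) hs
    filter_upwards [γ.continuous.continuousAt.eventually h1] with s h2
    rw [h2, h1.self_of_nhds]
  · intro e' he' hs
    simp only
    rw [γ.source, hz.change_of_chart e he e' he' hx hs]
  · intro e' he' hs
    simp only
    rw [γ.target]

/-- Going back along one path and forth along the other gives a loop at `x`, whose holonomy `w' e /
w e` is `±1`. -/
theorem Transports.sq_eq (hO : ∀ h ∈ O.holonomyGroup, (h : ℂ) = 1 ∨ (h : ℂ) = -1) {p x : S}
    {z w w' : OpenPartialHomeomorph S ℂ → ℂ} (h : O.Transports p x z w) (h' : O.Transports p x z w')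
    {e : OpenPartialHomeomorph S ℂ} (he : e ∈ O.charts) (hx : x ∈ e.source) :
    w' e ^ 2 = w e ^ 2 := by
  have hw := h.right.norm_eq_one e he hx
  have hw' := h'.right.norm_eq_one e he hx
  have hw0 : w e ≠ 0 := norm_ne_zero_iff.1 (by rw [hw]; exact one_ne_zero)
  let c : Circle := ⟨w' e / w e, mem_sphere_zero_iff_norm.2 (by rw [norm_div, hw, hw', div_one])⟩
  have hc : (c : ℂ) = w' e / w e := rfl
  obtain ⟨γ, v, hr, hv, -, h0, h1⟩ := h.symm.trans h'
  have hhol : O.HasHolonomy γ c := ⟨hr, v, hv, e, he, hx, by rwa [h0 e he hx], by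
    rw [h0 e he hx, h1 e he hx, hc]; field_simp⟩
  have h2 : (w' e / w e) ^ 2 = 1 := by
    rw [← hc, sq_eq_one_iff]
    exact hO c (Subgroup.subset_closure ⟨x, γ, hhol⟩)
  rw [div_pow] at h2
  exact (div_eq_one_iff_eq (pow_ne_zero 2 hw0)).1 h2

variable (O) in
/-- A parallel quadratic form of norm one on the nonsingular part; `Q x e` is its coefficient at
`x` in the oriented flat chart `e`. -/
structure IsParallelQuadratic (Q : S → OpenPartialHomeomorph S ℂ → ℂ) : Prop where
  change_of_chart : ∀ x, IsRegularPoint x → ∀ e ∈ O.charts, ∀ e' ∈ O.charts, x ∈ e.source →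
    x ∈ e'.source → Q x e = Q x e' * deriv (e' ∘ e.symm) (e x) ^ 2
  locally_constant : ∀ x, IsRegularPoint x → ∀ e ∈ O.charts, x ∈ e.source →
    ∀ᶠ y in 𝓝 x, Q y e = Q x e
  norm_eq_one : ∀ x, IsRegularPoint x → ∀ e ∈ O.charts, x ∈ e.source → ‖Q x e‖ = 1

theorem exists_isParallelQuadratic [ConnectedSpace S] (hS : IsFlatConeMetric S)
    (hO : ∀ h ∈ O.holonomyGroup, (h : ℂ) = 1 ∨ (h : ℂ) = -1) {x₀ : S} (hx₀ : IsRegularPoint x₀) :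
    ∃ Q, O.IsParallelQuadratic Q := by
  have hU := isOpen_regular S hS.finite_singular
  obtain ⟨e₀, he₀, hs₀⟩ := O.covers x₀ hx₀
  have hz₀ := IsUnitVector.extend he₀ hs₀ (u := 1) (by simp)
  set z₀ : OpenPartialHomeomorph S ℂ → ℂ := fun e' => deriv (e' ∘ e₀.symm) (e₀ x₀) * 1
  have hreach : ∀ x, IsRegularPoint x → ∃ w, O.Transports x₀ x z₀ w := by
    intro x hx
    -- That every unit vector at `x` can be transported to `y` is a transitive relation, and it
    -- holds in both directions between nearby points. On a connected set it holds between any two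
    -- points.
    refine (hS.isPreconnected_regular O).induction₂'
      (fun x y => ∀ z, O.IsUnitVector x z → ∃ w, O.Transports x y z w) ?_ ?_ hx₀ hx z₀ hz₀
    · intro x hx
      obtain ⟨e, he, hs⟩ := O.covers x hx
      obtain ⟨V, hV, hVe, hT⟩ := exists_nhds_transports hU hx he hs
      filter_upwards [mem_nhdsWithin_of_mem_nhds hV] with y hy
      exact ⟨fun z hz => ⟨_, hT x (mem_of_mem_nhds hV) y hy z hz⟩,
        fun z hz => ⟨_, hT y hy x (mem_of_mem_nhds hV) z hz⟩⟩
    · intro x y y' _ _ _ h1 h2 z hz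
      obtain ⟨w, hw⟩ := h1 z hz
      obtain ⟨w', hw'⟩ := h2 w hw.right
      exact ⟨w', hw.trans hw'⟩
  choose! w hw using hreach
  have hn : ∀ x, IsRegularPoint x → ∀ e ∈ O.charts, x ∈ e.source → ‖w x e‖ = 1 :=
    fun x hx => (hw x hx).right.norm_eq_one
  -- This is the form that takes the value 1 on `w x`; the sign ambiguity of `w x` disappears in the
  -- square.
  refine ⟨fun x e => (w x e ^ 2)⁻¹, ?_, ?_, ?_⟩
  · intro x hx e he e' he' hs hs'
    have h1 := (hw x hx).right.change_of_chart e he e' he' hs hs'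
    have h2 : w x e' ≠ 0 := norm_ne_zero_iff.1 (by rw [hn x hx e' he' hs']; exact one_ne_zero)
    simp only [h1] at h2 ⊢
    have h3 := left_ne_zero_of_mul h2
    have h4 := right_ne_zero_of_mul h2
    field_simp
  · intro x hx e he hs
    obtain ⟨V, hV, hVe, hT⟩ := exists_nhds_transports hU hx he hs
    filter_upwards [hV, hU.mem_nhds hx] with y hy hyr
    have h1 := (hw x hx).trans (hT x (mem_of_mem_nhds hV) y hy _ (hw x hx).right)
    rw [(hw y hyr).sq_eq hO h1 he (hVe hy) |>.symm, deriv_self (hVe hy), one_mul]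
  · intro x hx e he hs
    rw [norm_inv, norm_pow, hn x hx e he hs]; simp

end FlatOrientation

/-! ### Coordinates that are conformal for the flat charts -/

section ChainRule

variable {X : Type*} [TopologicalSpace X]

theorem comp_symm_eventuallyEq {φ ψ : OpenPartialHomeomorph X ℂ} {g : X → ℂ} {x : X}
    (hφ : x ∈ φ.source) (hψ : x ∈ ψ.source) :
    g ∘ φ.symm =ᶠ[𝓝 (φ x)] (g ∘ ψ.symm) ∘ (ψ ∘ φ.symm) := by
  filter_upwards [(φ.tendsto_symm hφ).eventually (ψ.open_source.mem_nhds hψ)] with z hz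
  simp only [Function.comp]
  rw [ψ.left_inv hz]

theorem analyticAt_comp_symm {φ ψ : OpenPartialHomeomorph X ℂ} {g : X → ℂ} {x : X}
    (hφ : x ∈ φ.source) (hψ : x ∈ ψ.source) (h1 : AnalyticAt ℂ (g ∘ ψ.symm) (ψ x))
    (h2 : AnalyticAt ℂ (ψ ∘ φ.symm) (φ x)) : AnalyticAt ℂ (g ∘ φ.symm) (φ x) := by
  refine AnalyticAt.congr (AnalyticAt.comp ?_ h2) (comp_symm_eventuallyEq hφ hψ).symm
  simpa [φ.left_inv hφ] using h1

theorem deriv_comp_symm {φ ψ : OpenPartialHomeomorph X ℂ} {g : X → ℂ} {x : X}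
    (hφ : x ∈ φ.source) (hψ : x ∈ ψ.source) (h1 : AnalyticAt ℂ (g ∘ ψ.symm) (ψ x))
    (h2 : AnalyticAt ℂ (ψ ∘ φ.symm) (φ x)) :
    deriv (g ∘ φ.symm) (φ x) = deriv (g ∘ ψ.symm) (ψ x) * deriv (ψ ∘ φ.symm) (φ x) := by
  have hx : (ψ ∘ φ.symm) (φ x) = ψ x := by simp [φ.left_inv hφ]
  rw [(comp_symm_eventuallyEq hφ hψ).deriv_eq, deriv_comp _ (by rw [hx]; exact h1.differentiableAt)
    h2.differentiableAt, hx]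

theorem analyticAt_comp_symm_of_affine {φ e : OpenPartialHomeomorph X ℂ} {x : X}
    (he : x ∈ e.source) {a b : ℂ}
    (h : ∀ᶠ y in 𝓝 x, φ y = a * e y + b) : AnalyticAt ℂ (φ ∘ e.symm) (e x) := by
  have : AnalyticAt ℂ (fun z => a * z + b) (e x) := by fun_prop
  refine this.congr ?_
  filter_upwards [(e.tendsto_symm he).eventually h, e.eventually_right_inverse' he] with z h1 h2
  rw [Function.comp, h1, h2]

end ChainRule

namespace FlatOrientation

variable (O : FlatOrientation S)

/-- A coordinate that is holomorphic with respect to the oriented flat charts. -/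
def IsConformal (φ : OpenPartialHomeomorph S ℂ) : Prop :=
  ∀ x ∈ φ.source, IsRegularPoint x → ∀ e ∈ O.charts, x ∈ e.source →
    AnalyticAt ℂ (φ ∘ e.symm) (e x) ∧ AnalyticAt ℂ (e ∘ φ.symm) (φ x)

variable {O}

theorem isConformal_of_affine {φ e : OpenPartialHomeomorph S ℂ} (he : e ∈ O.charts)
    (hs : φ.source ⊆ e.source) {a : ℂ} (ha : a ≠ 0) (h : ∀ x ∈ φ.source, φ x = a * e x) :
    O.IsConformal φ := by
  intro x hx _ e' he' hx'
  obtain ⟨c, d, hcd, -⟩ := O.exists_transition he' he hx' (hs hx)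
  have hev : ∀ᶠ y in 𝓝 x, φ y = (a * c) * e' y + a * d := by
    filter_upwards [hcd, φ.open_source.mem_nhds hx] with y h1 h2
    rw [h y h2, h1]; ring
  refine ⟨analyticAt_comp_symm_of_affine hx' hev, ?_⟩
  refine analyticAt_comp_symm_of_affine (a := (a * c)⁻¹) (b := -d / c) hx ?_
  have hc := c.coe_ne_zero
  filter_upwards [hev] with y h1
  rw [h1]; field_simp; ring

theorem isConformal_of_mem {e : OpenPartialHomeomorph S ℂ} (he : e ∈ O.charts) :
    O.IsConformal e :=
  isConformal_of_affine he subset_rfl one_ne_zero fun _ _ => (one_mul _).symm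

theorem eventually_isRegularPoint (hS : {p : S | ¬ IsRegularPoint p}.Finite) (x : S) :
    ∀ᶠ y in 𝓝[≠] x, IsRegularPoint y := by
  have : ({p : S | ¬ IsRegularPoint p} \ {x})ᶜ ∈ 𝓝 x :=
    (hS.subset sdiff_subset).isClosed.isOpen_compl.mem_nhds (by simp)
  filter_upwards [mem_nhdsWithin_of_mem_nhds this, self_mem_nhdsWithin] with y h1 h2
  by_contra h
  exact h1 ⟨h, h2⟩

theorem tendsto_symm_punctured {φ : OpenPartialHomeomorph S ℂ} {x : S} (hx : x ∈ φ.source) :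
    Tendsto φ.symm (𝓝[≠] (φ x)) (𝓝[≠] x) := by
  refine tendsto_nhdsWithin_iff.2 ⟨(φ.tendsto_symm hx).mono_left nhdsWithin_le_nhds, ?_⟩
  filter_upwards [self_mem_nhdsWithin, mem_nhdsWithin_of_mem_nhds
    (φ.open_target.mem_nhds (φ.map_source hx))] with z h1 h2 h3
  apply h1
  rw [← φ.right_inv h2, (h3 : φ.symm z = x)]; rfl

/-- Conformality is tested at nonsingular points only. As singular points are isolated and the
transition is continuous, it is holomorphic at them too by removable singularities. -/
theorem IsConformal.analyticAt_transition (hS : {p : S | ¬ IsRegularPoint p}.Finite)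
    {φ ψ : OpenPartialHomeomorph S ℂ} (hφ : O.IsConformal φ) (hψ : O.IsConformal ψ) {x : S}
    (hx : x ∈ φ.source) (hx' : x ∈ ψ.source) : AnalyticAt ℂ (ψ ∘ φ.symm) (φ x) := by
  refine Complex.analyticAt_of_differentiable_on_punctured_nhds_of_continuousAt ?_ ?_
  · filter_upwards [(tendsto_symm_punctured hx).eventually (eventually_isRegularPoint hS x),
      mem_nhdsWithin_of_mem_nhds ((φ.tendsto_symm hx).eventually (ψ.open_source.mem_nhds hx')),
      mem_nhdsWithin_of_mem_nhds (φ.open_target.mem_nhds (φ.map_source hx))] with z h1 h2 h3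
    obtain ⟨e, he, hs⟩ := O.covers _ h1
    have h4 := φ.map_target h3
    have := analyticAt_comp_symm h4 hs (hψ _ h2 h1 e he hs).1 (hφ _ h4 h1 e he hs).2
    rw [φ.right_inv h3] at this
    exact this.differentiableAt
  · refine ContinuousAt.comp ?_ (φ.continuousAt_symm (φ.map_source hx))
    rw [φ.left_inv hx]
    exact ψ.continuousAt hx'

end FlatOrientation

/-! ### The conformal coordinate at a cone point -/

section ConeChart

/-- The inverse `z ↦ P (β log z)` of the conformal coordinate at a point of cone angle `2πβ`. -/
noncomputable def coneParam (p : S) (P : ℂ → S) (β : ℝ) (z : ℂ) : S :=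
  if z = 0 then p else P (β * log z)

variable {p : S} {θ R β : ℝ} {P : ℂ → S}

theorem re_mul_log_lt {z : ℂ} (hz0 : z ≠ 0) (hz : ‖z‖ ^ β < Real.exp R) :
    ((β : ℂ) * log z).re < R := by
  have hz' : 0 < ‖z‖ := norm_pos_iff.2 hz0
  rw [re_ofReal_mul, log_re]
  rw [Real.rpow_def_of_pos hz', Real.exp_lt_exp] at hz
  linarith

namespace IsPrePolar

/-- Another logarithm differs by `2πin`, and `β * 2πin = n * (θ * I)` is a period of `P`. -/
theorem coneParam_exp (h : IsPrePolar p θ R P) (hβ : θ = 2 * Real.pi * β) (ζ : ℂ) :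
    coneParam p P β (exp ζ) = P (β * ζ) := by
  rw [coneParam, if_neg (exp_ne_zero _)]
  obtain ⟨n, hn⟩ := exp_eq_exp_iff_exists_int.1 (exp_log (exp_ne_zero ζ))
  rw [hn, ← h.periodic_int n (β * ζ), hβ]
  congr 1
  push_cast
  ring

theorem dist_coneParam (h : IsPrePolar p θ R P) (hβ : 0 < β) {z : ℂ}
    (hz : ‖z‖ ^ β < Real.exp R) : dist (coneParam p P β z) p = ‖z‖ ^ β := by
  unfold coneParam
  split_ifs with h0
  · simp [h0, Real.zero_rpow hβ.ne']
  · rw [h.dist_center _ (re_mul_log_lt h0 hz), re_ofReal_mul, log_re,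
      Real.rpow_def_of_pos (norm_pos_iff.2 h0), mul_comm]

theorem injOn_coneParam (h : IsPrePolar p θ R P) (hβ : 0 < β) (hθ : θ = 2 * Real.pi * β) :
    InjOn (coneParam p P β) {z | ‖z‖ ^ β < Real.exp R} := by
  intro z hz z' hz' he
  have hd := h.dist_coneParam hβ hz
  rw [he, h.dist_coneParam hβ hz'] at hd
  have hnn : ‖z'‖ = ‖z‖ := (Real.rpow_left_inj (norm_nonneg _) (norm_nonneg _) hβ.ne').1 hd
  by_cases h0 : z = 0
  · rw [h0, norm_zero, norm_eq_zero] at hnn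
    rw [h0, hnn]
  · have h0' : z' ≠ 0 := norm_ne_zero_iff.1 (by rw [hnn]; exact norm_ne_zero_iff.2 h0)
    rw [coneParam, coneParam, if_neg h0, if_neg h0'] at he
    obtain ⟨n, hn⟩ := h.eq_iff (re_mul_log_lt h0 hz) (re_mul_log_lt h0' hz') he
    have hβ' : (β : ℂ) ≠ 0 := by exact_mod_cast hβ.ne'
    have : log z' = log z + n * (2 * Real.pi * I) := by
      apply mul_left_cancel₀ hβ'
      rw [hn, hθ]; push_cast; ring
    rw [← exp_log h0, ← exp_log h0', this, exp_add, exp_int_mul_two_pi_mul_I, mul_one]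

/-- Near `z₀` the principal logarithm may jump; it can be replaced by a branch that is analytic at
`z₀`. -/
theorem coneParam_eventuallyEq (h : IsPrePolar p θ R P) (hθ : θ = 2 * Real.pi * β) {z₀ : ℂ}
    (hz₀ : z₀ ≠ 0) : ∀ᶠ z in 𝓝 z₀, coneParam p P β z = P (β * (log (z / z₀) + log z₀)) := by
  filter_upwards [isOpen_ne.mem_nhds hz₀] with z hz
  rw [← h.coneParam_exp hθ, exp_add, exp_log (div_ne_zero hz hz₀), exp_log hz₀,
    div_mul_cancel₀ _ hz₀]

theorem hasDerivAt_branch {z₀ : ℂ} (hz₀ : z₀ ≠ 0) :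
    AnalyticAt ℂ (fun z => (β : ℂ) * (log (z / z₀) + log z₀)) z₀ ∧
      HasDerivAt (fun z => (β : ℂ) * (log (z / z₀) + log z₀)) (β / z₀) z₀ := by
  have hsl : z₀ / z₀ ∈ slitPlane := by rw [div_self hz₀]; exact one_mem_slitPlane
  constructor
  · have : AnalyticAt ℂ (fun z => log (z / z₀)) z₀ := AnalyticAt.clog (by fun_prop (disch := simpa)) hsl
    fun_prop
  · have := ((((hasDerivAt_id z₀).div_const z₀).clog hsl).add_const (log z₀)).const_mul (β : ℂ)
    refine this.congr_deriv ?_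
    simp only [id]
    field_simp

theorem branch_self {z₀ : ℂ} (hz₀ : z₀ ≠ 0) :
    (β : ℂ) * (log (z₀ / z₀) + log z₀) = β * log z₀ := by
  rw [div_self hz₀, log_one, zero_add]

theorem continuousOn_coneParam (h : IsPrePolar p θ R P) (hβ : 0 < β)
    (hθ : θ = 2 * Real.pi * β) : ContinuousOn (coneParam p P β) {z | ‖z‖ ^ β < Real.exp R} := by
  have hcn : Continuous fun z : ℂ => ‖z‖ ^ β :=
    continuous_norm.rpow_const fun _ => Or.inr hβ.le
  intro z₀ hz₀
  apply ContinuousAt.continuousWithinAt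
  by_cases h0 : z₀ = 0
  · rw [ContinuousAt, tendsto_iff_dist_tendsto_zero]
    have h1 : coneParam p P β z₀ = p := if_pos h0
    have h2 : Tendsto (fun z : ℂ => ‖z‖ ^ β) (𝓝 z₀) (𝓝 0) := by
      have := hcn.tendsto z₀
      rwa [h0, norm_zero, Real.zero_rpow hβ.ne', ← h0] at this
    refine h2.congr' ?_
    filter_upwards [hcn.continuousAt.eventually (gt_mem_nhds hz₀)] with z hz
    rw [h1, h.dist_coneParam hβ hz]
  · have hc : ContinuousAt (fun z => P (β * (log (z / z₀) + log z₀))) z₀ := by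
      refine ContinuousAt.comp (g := P) ?_ (hasDerivAt_branch h0).1.continuousAt
      rw [branch_self h0]
      exact h.continuousAt (re_mul_log_lt h0 hz₀)
    exact hc.congr_of_eventuallyEq (h.coneParam_eventuallyEq hθ h0)

theorem image_coneParam (h : IsPrePolar p θ R P) (hβ : 0 < β) (hθ : θ = 2 * Real.pi * β) {r : ℝ}
    (hr : 0 < r) (hrR : r ^ β < Real.exp R) :
    coneParam p P β '' ball 0 r = ball p (r ^ β) := by
  have hmem : ∀ z ∈ ball (0 : ℂ) r, ‖z‖ ^ β < r ^ β := fun z hz =>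
    Real.rpow_lt_rpow (norm_nonneg _) (by simpa using hz) hβ
  ext x
  constructor
  · rintro ⟨z, hz, rfl⟩
    rw [Metric.mem_ball, h.dist_coneParam hβ ((hmem z hz).trans hrR)]
    exact hmem z hz
  · intro hx
    by_cases hxp : x = p
    · exact ⟨0, mem_ball_self hr, by rw [hxp, coneParam, if_pos rfl]⟩
    · obtain ⟨ζ, hζ, rfl⟩ := h.surj x (ball_subset_ball hrR.le hx) hxp
      rw [Metric.mem_ball, h.dist_center ζ hζ, Real.rpow_def_of_pos hr, Real.exp_lt_exp] at hx
      have hβ' : (β : ℂ) ≠ 0 := by exact_mod_cast hβ.ne'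
      refine ⟨exp (ζ / β), ?_, ?_⟩
      · rw [mem_ball_zero_iff, norm_exp, div_ofReal_re, ← Real.lt_log_iff_exp_lt hr, div_lt_iff₀ hβ]
        exact hx
      · rw [h.coneParam_exp hθ, mul_div_cancel₀ _ hβ']

/-- The conformal coordinate at a cone point, as a local homeomorphism. -/
theorem exists_coneChart (h : IsPrePolar p θ R P) (hβ : 0 < β) (hθ : θ = 2 * Real.pi * β) :
    ∃ φ : OpenPartialHomeomorph S ℂ, p ∈ φ.source ∧ (φ.symm : ℂ → S) = coneParam p P β ∧
      ∀ z ∈ φ.target, ‖z‖ ^ β < Real.exp R := by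
  set r := Real.exp ((R - 1) / β) with hr
  have hr0 : 0 < r := Real.exp_pos _
  have hrR : r ^ β < Real.exp R := by
    rw [hr, ← Real.exp_mul, div_mul_cancel₀ _ hβ.ne']
    exact Real.exp_lt_exp.2 (by linarith)
  have hcl : closedBall (0 : ℂ) r ⊆ {z | ‖z‖ ^ β < Real.exp R} := fun z hz =>
    (Real.rpow_le_rpow (norm_nonneg _) (by simpa using hz) hβ.le).trans_lt hrR
  have hinj := (h.injOn_coneParam hβ hθ).mono hcl
  have hcont := (h.continuousOn_coneParam hβ hθ).mono hcl
  have hbc : ball (0 : ℂ) r ⊆ closedBall 0 r := ball_subset_closedBall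
  let G : PartialEquiv ℂ S := (hinj.mono hbc).toPartialEquiv
  have hGs : G.source = ball 0 r := rfl
  -- By injectivity on the closed ball, the image of an open subset of the ball is the open ball
  -- `ball p (r ^ β)` minus the image of a compact set.
  have hopen : IsOpenMap (G.source.domRestrict G) := by
    intro V hV
    obtain ⟨V', hV', rfl⟩ := isOpen_induced_iff.1 hV
    have himg : G.source.domRestrict G '' (Subtype.val ⁻¹' V') =
        ball p (r ^ β) \ coneParam p P β '' (closedBall 0 r \ (ball 0 r ∩ V')) := by
      rw [← h.image_coneParam hβ hθ hr0 hrR]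
      ext x
      constructor
      · rintro ⟨⟨z, hz⟩, hzV, rfl⟩
        refine ⟨⟨z, hz, rfl⟩, ?_⟩
        rintro ⟨z', ⟨hz', hz'V⟩, he⟩
        have : z' = z := hinj hz' (hbc hz) he
        exact hz'V (this ▸ ⟨hz, hzV⟩)
      · rintro ⟨⟨z, hz, rfl⟩, hn⟩
        have hzV : z ∈ V' := by
          by_contra hc
          exact hn ⟨z, ⟨hbc hz, fun hh => hc hh.2⟩, rfl⟩
        exact ⟨⟨z, hz⟩, hzV, rfl⟩
    rw [himg]
    refine isOpen_ball.sdiff (IsCompact.isClosed ?_)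
    exact ((isCompact_closedBall 0 r).diff (isOpen_ball.inter hV')).image_of_continuousOn
      (hcont.mono sdiff_subset)
  let φ := (OpenPartialHomeomorph.ofContinuousOpenRestrict G (hcont.mono hbc) hopen isOpen_ball).symm
  refine ⟨φ, ?_, rfl, fun z hz => hcl (hbc hz)⟩
  exact ⟨0, mem_ball_self hr0, if_pos rfl⟩

end IsPrePolar

/-- The conformal coordinate at a singular point of cone angle `2πβ`; the flat coordinate is `z ^ β` up to
a motion. -/
theorem IsPolar.exists_coneChart {O : FlatOrientation S} (h : IsPolar O p θ R P)
    (hsing : ¬ IsRegularPoint p) (hβ : 0 < β) (hθ : θ = 2 * Real.pi * β) :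
    ∃ φ : OpenPartialHomeomorph S ℂ, p ∈ φ.source ∧ O.IsConformal φ ∧ φ p = 0 ∧
      ∀ x ∈ φ.source, x ≠ p → ∀ e ∈ O.charts, x ∈ e.source →
        ‖deriv (e ∘ φ.symm) (φ x)‖ = β * ‖φ x‖ ^ (β - 1) := by
  obtain ⟨φ, hp, hφ, hφt⟩ := h.toIsPrePolar.exists_coneChart hβ hθ
  have hinj := h.toIsPrePolar.injOn_coneParam hβ hθ
  have hz : φ p = 0 := by
    refine hinj (hφt _ (φ.map_source hp)) (by simp [Real.zero_rpow hβ.ne', Real.exp_pos]) ?_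
    rw [← hφ, φ.left_inv hp, hφ, coneParam, if_pos rfl]
  have hne : ∀ x ∈ φ.source, x ≠ p → φ x ≠ 0 := fun x hx hxp he =>
    hxp (φ.injOn hx hp (he.trans hz.symm))
  have key : ∀ x ∈ φ.source, x ≠ p → ∀ e ∈ O.charts, x ∈ e.source →
      AnalyticAt ℂ (e ∘ φ.symm) (φ x) ∧ ∃ c : Circle,
        HasDerivAt (e ∘ φ.symm) (c * (exp (β * log (φ x)) * (β / φ x))) (φ x) := by
    intro x hx hxp e he hs
    have h0 := hne x hx hxp
    have hre := re_mul_log_lt h0 (hφt _ (φ.map_source hx))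
    have hPx : P (β * log (φ x)) = x := by
      have := φ.left_inv hx
      rwa [hφ, coneParam, if_neg h0] at this
    obtain ⟨c, d, hcd⟩ := h.motion _ hre e he (by rwa [hPx])
    obtain ⟨hLa, hLd⟩ := IsPrePolar.hasDerivAt_branch (β := β) h0
    set L : ℂ → ℂ := fun z => (β : ℂ) * (log (z / φ x) + log (φ x)) with hL
    have hL0 : L (φ x) = β * log (φ x) := IsPrePolar.branch_self h0
    -- The flat chart is a branch of `c * z ^ β + d`, with derivative of absolute value `β * ‖z‖ ^
    -- (β - 1)`.
    have hev : e ∘ φ.symm =ᶠ[𝓝 (φ x)] fun z => c * exp (L z) + d := by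
      have hLc : Tendsto L (𝓝 (φ x)) (𝓝 (β * log (φ x))) := hL0 ▸ hLa.continuousAt
      filter_upwards [h.toIsPrePolar.coneParam_eventuallyEq hθ h0, hLc.eventually hcd] with z h1 h2
      rw [Function.comp, hφ, h1, h2]
    constructor
    · have : AnalyticAt ℂ (fun z => c * exp (L z) + d) (φ x) := by fun_prop
      exact this.congr hev.symm
    · refine ⟨c, ?_⟩
      have := ((hLd.cexp.const_mul (c : ℂ)).add_const d).congr_of_eventuallyEq hev
      rwa [hL0] at this
  have hβ' : (β : ℂ) ≠ 0 := by exact_mod_cast hβ.ne'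
  refine ⟨φ, hp, ?_, hz, ?_⟩
  · intro x hx hreg e he hs
    have hxp : x ≠ p := fun hxp => hsing (hxp ▸ hreg)
    obtain ⟨han, c, hd⟩ := key x hx hxp e he hs
    refine ⟨?_, han⟩
    have h0 := hne x hx hxp
    let g := φ.symm.trans e
    have hgt : e x ∈ g.target := by simp [g, e.map_source hs, hs, hx]
    have hgx : g.symm (e x) = φ x := by simp [g, e.left_inv hs]
    have hne0 : (c : ℂ) * (exp (β * log (φ x)) * (β / φ x)) ≠ 0 :=
      mul_ne_zero c.coe_ne_zero (mul_ne_zero (exp_ne_zero _) (div_ne_zero hβ' h0))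
    have := g.contDiffAt_symm_deriv (n := ω) hne0 hgt (by rw [hgx]; exact hd)
      (by rw [hgx]; exact han.contDiffAt)
    exact this.analyticAt
  · intro x hx hxp e he hs
    obtain ⟨han, c, hd⟩ := key x hx hxp e he hs
    have h0 := norm_pos_iff.2 (hne x hx hxp)
    rw [hd.deriv, norm_mul, c.norm_coe, one_mul, norm_mul, norm_exp, re_ofReal_mul, log_re,
      norm_div, norm_real, Real.norm_of_nonneg hβ.le, Real.rpow_sub_one h0.ne',
      Real.rpow_def_of_pos h0, mul_comm β]
    ring

end ConeChart

/-! ### The Riemann surface and its quadratic differential -/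

section Construction

variable {S : Type*} [MetricSpace S] {O : FlatOrientation S}

namespace IsFlatConeMetric

/-- Here `β = θ / 2π`. The strict inequality `1 < β` is what makes the differential vanish, rather
than blow up, at the cone point. -/
theorem exists_coneChart (hS : IsFlatConeMetric S) (O : FlatOrientation S) {p : S}
    (hp : ¬ IsRegularPoint p) : ∃ (φ : OpenPartialHomeomorph S ℂ) (β : ℝ), 1 < β ∧ p ∈ φ.source ∧
      O.IsConformal φ ∧ φ p = 0 ∧
      ∀ x ∈ φ.source, x ≠ p → ∀ e ∈ O.charts, x ∈ e.source →
        ‖deriv (e ∘ φ.symm) (φ x)‖ = β * ‖φ x‖ ^ (β - 1) := by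
  obtain ⟨θ, R, P, hθ, hcone, hP⟩ := hS.exists_isPolar O p
  have hpi := Real.pi_pos
  have hne : 2 * Real.pi < θ := by
    refine lt_of_le_of_ne hθ fun h => hp ?_
    rw [← h] at hcone
    exact hcone
  have hβ : 1 < θ / (2 * Real.pi) := by rwa [one_lt_div (by positivity)]
  obtain ⟨φ, h⟩ := hP.exists_coneChart hp (zero_lt_one.trans hβ)
    (mul_div_cancel₀ θ (by positivity)).symm
  exact ⟨φ, _, hβ, h⟩

theorem exists_isConformal (hS : IsFlatConeMetric S) (O : FlatOrientation S) (p : S) :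
    ∃ φ : OpenPartialHomeomorph S ℂ, p ∈ φ.source ∧ O.IsConformal φ := by
  by_cases hp : IsRegularPoint p
  · obtain ⟨e, he, hs⟩ := O.covers p hp
    exact ⟨e, hs, FlatOrientation.isConformal_of_mem he⟩
  · obtain ⟨φ, β, -, hs, hφ, -⟩ := hS.exists_coneChart O hp
    exact ⟨φ, hs, hφ⟩

/-- The Riemann surface structure of an oriented flat cone surface. -/
@[reducible]
noncomputable def conformalStructure (hS : IsFlatConeMetric S) (O : FlatOrientation S) :
    ChartedSpace ℂ S where
  atlas := {φ | O.IsConformal φ}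
  chartAt p := (hS.exists_isConformal O p).choose
  mem_chart_source p := (hS.exists_isConformal O p).choose_spec.1
  chart_mem_atlas p := (hS.exists_isConformal O p).choose_spec.2

theorem isManifold_conformalStructure (hS : IsFlatConeMetric S) (O : FlatOrientation S) :
    letI := hS.conformalStructure O
    IsManifold 𝓘(ℂ) ω S := by
  let _ := hS.conformalStructure O
  have key : ∀ φ ψ : OpenPartialHomeomorph S ℂ, O.IsConformal φ → O.IsConformal ψ →
      ∀ z ∈ (φ.symm.trans ψ).source, AnalyticAt ℂ (φ.symm.trans ψ) z := by
    intro φ ψ hφ hψ z hz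
    simp only [OpenPartialHomeomorph.trans_source, OpenPartialHomeomorph.symm_source] at hz
    have := hφ.analyticAt_transition hS.finite_singular hψ (φ.map_target hz.1) hz.2
    rwa [φ.right_inv hz.1] at this
  have : HasGroupoid S (contDiffGroupoid ω 𝓘(ℂ)) :=
    ⟨fun {φ ψ} hφ hψ => mem_contDiffGroupoid_of_analyticOn (key φ ψ hφ hψ) fun z hz =>
      key ψ φ hψ hφ z hz⟩
  exact IsManifold.mk' _ _ _

/-- Quadratic differentials are given on the maximal atlas. A coordinate in it is conformal because
the flat charts belong to the atlas. -/
theorem mem_maximalAtlas_iff (hS : IsFlatConeMetric S) {φ : OpenPartialHomeomorph S ℂ} :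
    letI := hS.conformalStructure O
    φ ∈ IsManifold.maximalAtlas 𝓘(ℂ) ω S ↔ O.IsConformal φ := by
  let _ := hS.conformalStructure O
  have := hS.isManifold_conformalStructure O
  have hmem : ∀ ψ : OpenPartialHomeomorph S ℂ, O.IsConformal ψ →
      ψ ∈ IsManifold.maximalAtlas 𝓘(ℂ) ω S := fun ψ hψ => IsManifold.subset_maximalAtlas hψ
  refine ⟨fun hφ x hx hr e he hs => ?_, hmem φ⟩
  have he' := hmem e (FlatOrientation.isConformal_of_mem he)
  exact ⟨analyticAt_transition he' hφ hs hx, analyticAt_transition hφ he' hx hs⟩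

end IsFlatConeMetric

namespace FlatOrientation

open Classical in
/-- The coefficient in the coordinate `φ` of a parallel quadratic form, extended by zero to the
singular points. -/
noncomputable def quadraticCoeff (O : FlatOrientation S) (Q : S → OpenPartialHomeomorph S ℂ → ℂ)
    (φ : OpenPartialHomeomorph S ℂ) (z : ℂ) : ℂ :=
  if h : IsRegularPoint (φ.symm z) then
    Q (φ.symm z) (O.covers _ h).choose * deriv ((O.covers _ h).choose ∘ φ.symm) z ^ 2
  else 0

variable {Q : S → OpenPartialHomeomorph S ℂ → ℂ} {φ : OpenPartialHomeomorph S ℂ} {x : S}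

theorem quadraticCoeff_of_not_isRegularPoint (hx : x ∈ φ.source) (hr : ¬ IsRegularPoint x) :
    O.quadraticCoeff Q φ (φ x) = 0 := by
  rw [quadraticCoeff, dif_neg]
  rwa [φ.left_inv hx]

namespace IsParallelQuadratic

/-- The flat chart chosen in the definition does not matter, as `Q` changes by the square of the
derivative of the coordinate change. -/
theorem quadraticCoeff_eq (hQ : O.IsParallelQuadratic Q) (hφ : O.IsConformal φ)
    (hx : x ∈ φ.source) (hr : IsRegularPoint x) {e : OpenPartialHomeomorph S ℂ}
    (he : e ∈ O.charts) (hs : x ∈ e.source) :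
    O.quadraticCoeff Q φ (φ x) = Q x e * deriv (e ∘ φ.symm) (φ x) ^ 2 := by
  have hr' : IsRegularPoint (φ.symm (φ x)) := by rwa [φ.left_inv hx]
  rw [quadraticCoeff, dif_pos hr']
  obtain ⟨he', hs'⟩ := (O.covers _ hr').choose_spec
  generalize (O.covers _ hr').choose = e' at he' hs' ⊢
  rw [φ.left_inv hx] at hs' ⊢
  rw [hQ.change_of_chart x hr e he e' he' hs hs',
    deriv_comp_symm hx hs (isConformal_of_mem he' x hs' hr e he hs).1 (hφ x hx hr e he hs).2]
  ring

theorem quadraticCoeff_transform (hQ : O.IsParallelQuadratic Q)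
    (hS : {p : S | ¬ IsRegularPoint p}.Finite) (hφ : O.IsConformal φ)
    {ψ : OpenPartialHomeomorph S ℂ} (hψ : O.IsConformal ψ) (hx : x ∈ φ.source)
    (hx' : x ∈ ψ.source) : O.quadraticCoeff Q φ (φ x) =
      O.quadraticCoeff Q ψ (ψ x) * deriv (ψ ∘ φ.symm) (φ x) ^ 2 := by
  by_cases hr : IsRegularPoint x
  · obtain ⟨e, he, hs⟩ := O.covers x hr
    rw [hQ.quadraticCoeff_eq hφ hx hr he hs, hQ.quadraticCoeff_eq hψ hx' hr he hs,
      deriv_comp_symm hx hx' (hψ x hx' hr e he hs).2 (hφ.analyticAt_transition hS hψ hx hx')]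
    ring
  · rw [quadraticCoeff_of_not_isRegularPoint hx hr, quadraticCoeff_of_not_isRegularPoint hx' hr,
      zero_mul]

theorem analyticAt_quadraticCoeff_of_isRegularPoint (hQ : O.IsParallelQuadratic Q)
    (hS : IsFlatConeMetric S) (hφ : O.IsConformal φ) (hx : x ∈ φ.source) (hr : IsRegularPoint x) :
    AnalyticAt ℂ (O.quadraticCoeff Q φ) (φ x) := by
  obtain ⟨e, he, hs⟩ := O.covers x hr
  have h1 : AnalyticAt ℂ (fun z => Q x e * deriv (e ∘ φ.symm) z ^ 2) (φ x) :=
    analyticAt_const.mul ((hφ x hx hr e he hs).2.deriv.pow 2)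
  refine h1.congr ?_
  have hev : ∀ᶠ y in 𝓝 x, IsRegularPoint y ∧ y ∈ e.source ∧ y ∈ φ.source ∧ Q y e = Q x e :=
    Filter.Eventually.and ((isOpen_regular S hS.finite_singular).mem_nhds hr)
      (Filter.Eventually.and (e.open_source.mem_nhds hs)
        (Filter.Eventually.and (φ.open_source.mem_nhds hx) (hQ.locally_constant x hr e he hs)))
  filter_upwards [eventually_symm hx hev] with z hz
  obtain ⟨⟨h1, h2, h3, h4⟩, h5⟩ := hz
  have := hQ.quadraticCoeff_eq hφ h3 h1 he h2
  rw [h5, h4] at this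
  exact this.symm

/-- In the cone coordinate `ψ` the coefficient has absolute value `(β * ‖ψ‖ ^ (β - 1)) ^ 2`, because
`‖Q‖ = 1`. Passing to `φ` multiplies this by the bounded factor `‖deriv (ψ ∘ φ.symm)‖ ^ 2`, so the
limit at the cone point is 0. -/
theorem continuousAt_quadraticCoeff_of_not_isRegularPoint (hQ : O.IsParallelQuadratic Q)
    (hS : IsFlatConeMetric S) (hφ : O.IsConformal φ) (hx : x ∈ φ.source)
    (hr : ¬ IsRegularPoint x) : ContinuousAt (O.quadraticCoeff Q φ) (φ x) := by
  obtain ⟨ψ, β, hβ, hxψ, hψ, hψ0, hder⟩ := hS.exists_coneChart O hr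
  have hτ := hφ.analyticAt_transition hS.finite_singular hψ hx hxψ
  have hτ0 : (ψ ∘ φ.symm) (φ x) = 0 := by simp [φ.left_inv hx, hψ0]
  let B : ℂ → ℝ := fun z =>
    (β * ‖(ψ ∘ φ.symm) z‖ ^ (β - 1)) ^ 2 * ‖deriv (ψ ∘ φ.symm) z‖ ^ 2
  have hB : ContinuousAt B (φ x) := by
    refine ContinuousAt.mul (ContinuousAt.pow (continuousAt_const.mul ?_) 2)
      (hτ.deriv.continuousAt.norm.pow 2)
    exact hτ.continuousAt.norm.rpow_const (Or.inr (by linarith))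
  have hB0 : B (φ x) = 0 := by
    simp only [B, hτ0, norm_zero, Real.zero_rpow (by linarith : β - 1 ≠ 0)]
    simp
  have hev : ∀ᶠ z in 𝓝 (φ x), ‖O.quadraticCoeff Q φ z‖ = B z := by
    have h1 := eventually_isRegularPoint hS.finite_singular x
    rw [eventually_nhdsWithin_iff] at h1
    filter_upwards [eventually_symm hx h1, eventually_symm hx (φ.open_source.mem_nhds hx),
      eventually_symm hx (ψ.open_source.mem_nhds hxψ)] with z hz1 hz2 hz3
    set y := φ.symm z with hy
    have hzy : φ y = z := hz1.2
    by_cases hyx : y = x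
    · rw [← hzy, hyx, hB0, quadraticCoeff_of_not_isRegularPoint hx hr, norm_zero]
    · have hyr := hz1.1 hyx
      obtain ⟨e, he, hs⟩ := O.covers y hyr
      rw [← hzy, hQ.quadraticCoeff_transform hS.finite_singular hφ hψ hz2.1 hz3.1,
        hQ.quadraticCoeff_eq hψ hz3.1 hyr he hs, norm_mul, norm_mul, hQ.norm_eq_one y hyr e he hs,
        norm_pow, norm_pow, hder y hz3.1 hyx e he hs, one_mul]
      simp only [B, Function.comp, φ.left_inv hz2.1]
  have hx0 : O.quadraticCoeff Q φ (φ x) = 0 := quadraticCoeff_of_not_isRegularPoint hx hr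
  rw [ContinuousAt, hx0, tendsto_zero_iff_norm_tendsto_zero]
  have := hB.tendsto
  rw [hB0] at this
  exact this.congr' (hev.mono fun z hz => hz.symm)

theorem analyticAt_quadraticCoeff (hQ : O.IsParallelQuadratic Q)
    (hS : IsFlatConeMetric S) (hφ : O.IsConformal φ) (hx : x ∈ φ.source) :
    AnalyticAt ℂ (O.quadraticCoeff Q φ) (φ x) := by
  by_cases hr : IsRegularPoint x
  · exact hQ.analyticAt_quadraticCoeff_of_isRegularPoint hS hφ hx hr
  · refine Complex.analyticAt_of_differentiable_on_punctured_nhds_of_continuousAt ?_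
      (hQ.continuousAt_quadraticCoeff_of_not_isRegularPoint hS hφ hx hr)
    filter_upwards [(tendsto_symm_punctured hx).eventually
        (eventually_isRegularPoint hS.finite_singular x),
      mem_nhdsWithin_of_mem_nhds (φ.open_target.mem_nhds (φ.map_source hx))] with z h1 h2
    have := hQ.analyticAt_quadraticCoeff_of_isRegularPoint hS hφ (φ.map_target h2) h1
    rw [φ.right_inv h2] at this
    exact this.differentiableAt

/-- The holomorphic quadratic differential given by a parallel quadratic form. -/
noncomputable def quadraticDifferential (hQ : O.IsParallelQuadratic Q) (hS : IsFlatConeMetric S) :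
    letI := hS.conformalStructure O
    HolomorphicQuadraticDifferential S :=
  letI := hS.conformalStructure O
  { coeff := O.quadraticCoeff Q
    holomorphic := fun φ hφ z hz => by
      have := hQ.analyticAt_quadraticCoeff hS (hS.mem_maximalAtlas_iff.1 hφ) (φ.map_target hz)
      rw [φ.right_inv hz] at this
      exact this.differentiableAt.differentiableWithinAt
    transform := fun φ hφ ψ hψ p hp hp' => hQ.quadraticCoeff_transform hS.finite_singular
      (hS.mem_maximalAtlas_iff.1 hφ) (hS.mem_maximalAtlas_iff.1 hψ) hp hp' }

/-- Multiplying a flat chart by a square root of the coefficient of the quadratic form gives a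
natural coordinate. -/
theorem exists_naturalCoordinate (hQ : O.IsParallelQuadratic Q) (hS : IsFlatConeMetric S) {p : S}
    (hp : IsRegularPoint p) : ∃ ξ : OpenPartialHomeomorph S ℂ, p ∈ ξ.source ∧ O.IsConformal ξ ∧
      (∀ z ∈ ξ.target, O.quadraticCoeff Q ξ z = 1) ∧
      ∃ e ∈ O.charts, ∃ u : Circle, ξ.source ⊆ e.source ∧ ∀ x ∈ ξ.source, ξ x = u * e x := by
  obtain ⟨e, he, hs⟩ := O.covers p hp
  have hn := hQ.norm_eq_one p hp e he hs
  obtain ⟨u₀, hu₀⟩ := IsAlgClosed.exists_pow_nat_eq (Q p e) two_pos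
  have hu₀n : ‖u₀‖ = 1 := by
    rw [← hu₀, norm_pow] at hn
    exact (pow_eq_one_iff_of_nonneg (norm_nonneg _) two_ne_zero).1 hn
  let u : Circle := ⟨u₀, mem_sphere_zero_iff_norm.2 hu₀n⟩
  have hu : (u : ℂ) ^ 2 = Q p e := hu₀
  have hev : ∀ᶠ y in 𝓝 p, IsRegularPoint y ∧ Q y e = Q p e :=
    Filter.Eventually.and ((isOpen_regular S hS.finite_singular).mem_nhds hp)
      (hQ.locally_constant p hp e he hs)
  obtain ⟨V, hV, hVo, hpV⟩ := _root_.eventually_nhds_iff.1 hev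
  let ξ : OpenPartialHomeomorph S ℂ :=
    (e.restrOpen V hVo).transHomeomorph (Homeomorph.mulLeft₀ (u : ℂ) u.coe_ne_zero)
  have hξs : ξ.source = e.source ∩ V := rfl
  have hξ : ∀ x, ξ x = u * e x := fun x => rfl
  have hsub : ξ.source ⊆ e.source := inter_subset_left
  have hconf : O.IsConformal ξ :=
    isConformal_of_affine he hsub u.coe_ne_zero fun x _ => hξ x
  refine ⟨ξ, ⟨hs, hpV⟩, hconf, ?_, e, he, u, hsub, fun x _ => hξ x⟩
  intro z hz
  have hx := ξ.map_target hz
  obtain ⟨hr, hq⟩ := hV _ hx.2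
  have hd : HasDerivAt (e ∘ ξ.symm) ((u : ℂ)⁻¹) (ξ (ξ.symm z)) := by
    refine hasDerivAt_transition (b := 0) hx (Eventually.of_forall fun y => ?_)
    rw [hξ, add_zero, inv_mul_cancel_left₀ u.coe_ne_zero]
  have := hQ.quadraticCoeff_eq hconf hx hr he (hsub hx)
  rw [hd.deriv, ξ.right_inv hz, hq, ← hu, ← mul_pow, mul_inv_cancel₀ u.coe_ne_zero, one_pow] at this
  exact this

theorem isMetricOf (hQ : O.IsParallelQuadratic Q) (hS : IsFlatConeMetric S) {x₀ : S}
    (hx₀ : IsRegularPoint x₀) :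
    letI := hS.conformalStructure O
    IsMetricOf O (hQ.quadraticDifferential hS) := by
  let _ := hS.conformalStructure O
  have := hS.isManifold_conformalStructure O
  constructor
  · obtain ⟨ξ, hs, hξ, h1, -⟩ := hQ.exists_naturalCoordinate hS hx₀
    refine ⟨x₀, ?_⟩
    rw [HolomorphicQuadraticDifferential.nonzeroAt_iff _ (hS.mem_maximalAtlas_iff.2 hξ) hs]
    have : O.quadraticCoeff Q ξ (ξ x₀) ≠ 0 := by
      rw [h1 _ (ξ.map_source hs)]; exact one_ne_zero
    exact this
  · intro p hp
    have hr : IsRegularPoint p := by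
      by_contra hr
      exact hp (quadraticCoeff_of_not_isRegularPoint (mem_chart_source ℂ p) hr)
    obtain ⟨ξ, hs, hξ, h1, e, he, u, hsub, hu⟩ := hQ.exists_naturalCoordinate hS hr
    refine ⟨ξ, hs, ⟨hS.mem_maximalAtlas_iff.2 hξ, h1⟩, ?_, ?_⟩
    · intro x hx y hy
      rw [hu x hx, hu y hy, dist_eq_norm, ← mul_sub, norm_mul, u.norm_coe, one_mul,
        ← dist_eq_norm, O.isometric e he x (hsub hx) y (hsub hy)]
    · intro e' he' x hx hxξ
      obtain ⟨a, b, hab, -⟩ := O.exists_transition he' he hx (hsub hxξ)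
      refine ⟨u * a, u * b, ?_⟩
      filter_upwards [hab, ξ.open_source.mem_nhds hxξ] with y h2 h3
      rw [hu y h3, h2, Circle.coe_mul]; ring

end IsParallelQuadratic

end FlatOrientation

theorem IsFlatConeMetric.comesFromQuadraticDifferential [ConnectedSpace S]
    (hS : IsFlatConeMetric S)
    (hO : ∀ h ∈ O.holonomyGroup, (h : ℂ) = 1 ∨ (h : ℂ) = -1) :
    ComesFromQuadraticDifferential O := by
  obtain ⟨p⟩ := (inferInstance : Nonempty S)
  have := hS.neBot p
  obtain ⟨x₀, hx₀⟩ := (FlatOrientation.eventually_isRegularPoint hS.finite_singular p).exists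
  obtain ⟨Q, hQ⟩ := FlatOrientation.exists_isParallelQuadratic hS hO hx₀
  exact ⟨hS.conformalStructure O, hS.isManifold_conformalStructure O,
    hQ.quadraticDifferential hS, hQ.isMetricOf hS hx₀⟩

end Construction

end FlatConeSurfaces

theorem mainTheorem3 {S : Type*} [MetricSpace S] [CompactSpace S] [ConnectedSpace S]
    (hS : IsFlatConeMetric S) (O : FlatOrientation S) :
    ComesFromQuadraticDifferential O ↔
      ((∀ (p : S) (θ : ℝ), HasConeAngle p θ → θ ≠ 2 * Real.pi →
          ∃ k : ℤ, 3 ≤ k ∧ θ = k * Real.pi) ∧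
        ∀ h ∈ O.holonomyGroup, (h : ℂ) = 1 ∨ (h : ℂ) = -1) :=
  ⟨fun h => h.conditions hS, fun h => hS.comesFromQuadraticDifferential h.2⟩
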